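/- **Setting.** Let $\Omega=C([0,1],\mathbb R)$ carry the topology of uniform convergence and its Borel $\sigma$-algebra. Let $W=(W(s,t))_{s,t\ge 0}$ be a two-parameter Brownian sheet, i.e. a centred real Gaussian process with continuous sample paths and covariance $\mathrm E[W(s,t)W(s',t')]=\min(s,s')\min(t,t')$. Let $Y$ be the Ornstein–Uhlenbeck process in Wiener space, that is, the $\Omega$-valued process $Y_s:=\bigl(t\mapsto e^{-s/2}W(e^s,t)\bigr)_{t\in[0,1]}$, $s\ge 0$. For Borel $G\subseteq\Omega$ let $$\mathrm{Cap}(G):=\int_0^\infty e^{-s}\,\mathrm P\{\exists r\in[0,s]:\ Y_r\in G\}\,ds .$$ This is the probability that $Y$, killed at an independent mean-one exponential time, hits $G$. A property is said to hold for *quasi-every* $f\in\Omega$ if it holds for all $f$ in some Borel set $G\subseteq\Omega$ with $\mathrm{Cap}(G^{\mathsf c})=0$. **Theorem 7.1 (D. Williams).** For each $n$ let $0=\pi_{0,n}<\pi_{1,n}<\cdots<\pi_{k_n,n}=1$ be a partition of $[0,1]$ into $k_n$ intervals, and suppose that $$\sum_n\ \max_{1\le j\le k_n}(\pi_{j,n}-\pi_{j-1,n})<\infty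 .$$ Then quasi-every $f\in\Omega$ has the following property: for all $t\in[0,1]$, $$\lim_{n\to\infty}\ \sum_{j=1}^{k_n}\bigl|f(\pi_{j,n}t)-f(\pi_{j-1,n}t)\bigr|^2=t .$$ -/

import Mathlib

open MeasureTheory ProbabilityTheory
open scoped NNReal ENNReal

noncomputable section

/-- The (standard, two-parameter, real-valued) Brownian sheet: a centred Gaussian process
`W` on `[0,∞)²`, with continuous sample paths (each `W ω` is bundled as a continuous function),
and with covariance `E[W(s,t) W(s',t')] = min(s,s') min(t,t')`. These properties determine
the law of `W` uniquely. -/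
structure IsBrownianSheet {S : Type*} [MeasurableSpace S] (P : Measure S)
    (W : S → C(ℝ≥0 × ℝ≥0, ℝ)) : Prop where
  gaussian : IsGaussianProcess (fun (p : ℝ≥0 × ℝ≥0) (ω : S) => W ω p) P
  centered : ∀ p : ℝ≥0 × ℝ≥0, ∫ ω, W ω p ∂P = 0
  covariance : ∀ p q : ℝ≥0 × ℝ≥0,
    cov[fun ω => W ω p, fun ω => W ω q; P] = ((min p.1 q.1 * min p.2 q.2 : ℝ≥0) : ℝ)

/-- `U(s,t) = e^{-s/2} W(e^s,t)`, for a given path `w` of the sheet. -/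
def ouSheet (w : C(ℝ≥0 × ℝ≥0, ℝ)) (s t : ℝ≥0) : ℝ :=
  Real.exp (-(s : ℝ) / 2) * w ((Real.exp (s : ℝ)).toNNReal, t)

/-- The Ornstein–Uhlenbeck process in Wiener space: `Y_s` is the continuous function
`t ↦ U(s,t)` on `[0,1]`. -/
def ouProcess (w : C(ℝ≥0 × ℝ≥0, ℝ)) (s : ℝ≥0) : C(unitInterval, ℝ) where
  toFun t := ouSheet w s ⟨t, t.2.1⟩
  continuous_toFun := by
    unfold ouSheet
    exact continuous_const.mul
      (w.continuous.comp (continuous_const.prodMk (continuous_subtype_val.subtype_mk _)))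

/-- The capacity of `G`: the probability that the Ornstein–Uhlenbeck process, killed at an
independent mean-one exponential time, hits `G`, that is,
`∫₀^∞ e^{-s} P{∃ r ∈ [0,s], Y_r ∈ G} ds`. -/
def wienerCap {S : Type*} [MeasurableSpace S] (P : Measure S)
    (W : S → C(ℝ≥0 × ℝ≥0, ℝ)) (G : Set C(unitInterval, ℝ)) : ℝ≥0∞ :=
  ∫⁻ s in Set.Ioi (0 : ℝ), ENNReal.ofReal (Real.exp (-s)) *
    P {ω | ∃ r : ℝ≥0, (r : ℝ) ≤ s ∧ ouProcess (W ω) r ∈ G}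

/-- A Borel set `G` of continuous functions holds quasi-surely if its complement has
capacity zero. -/
def HoldsQuasiSurely {S : Type*} [MeasurableSpace S] (P : Measure S)
    (W : S → C(ℝ≥0 × ℝ≥0, ℝ)) (G : Set C(unitInterval, ℝ)) : Prop :=
  MeasurableSet[borel C(unitInterval, ℝ)] G ∧ wienerCap P W Gᶜ = 0

/-- Quasi-every `f` has property `p`: the property holds on some Borel set that holds
quasi-surely. -/
def QuasiEvery {S : Type*} [MeasurableSpace S] (P : Measure S)
    (W : S → C(ℝ≥0 × ℝ≥0, ℝ)) (p : C(unitInterval, ℝ) → Prop) : Prop :=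
  ∃ G : Set C(unitInterval, ℝ), HoldsQuasiSurely P W G ∧ ∀ f ∈ G, p f

/-- A partition `0 = π₀ < π₁ < ⋯ < π_k = 1` of `[0,1]` into `k` intervals. -/
structure IsPartition {k : ℕ} (π : Fin (k + 1) → unitInterval) : Prop where
  strictMono : StrictMono π
  first : π 0 = 0
  last : π (Fin.last k) = 1

/-- The mesh `max_{1 ≤ j ≤ k} (π_j - π_{j-1})`. -/
def mesh {k : ℕ} (π : Fin (k + 1) → unitInterval) : ℝ :=
  ⨆ j : Fin k, ((π j.succ : ℝ) - (π j.castSucc : ℝ))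

end

/-! With `u = e^s` one has `Y_s(t) = u^(-1/2) W(u,t)`. So the claim concerns the deviation `X_n(u,t)
= ∑_j (W(u, π_j t) - W(u, π_{j-1} t))² - u t`, divided by `u`. Hitting the exceptional set before
time `s` involves only `1 ≤ u ≤ e^s`. It therefore suffices that almost surely `X_n → 0` uniformly
on `u ≤ U`, `t ≤ 1`, for every `U`. By Borel–Cantelli and summability of the meshes `δ_n`, this
follows from a tail bound of order `δ_n` for the supremum of `|X_n|`
(`IsBrownianSheet.measure_exists_deviation_gt_le`).

Two fourth-moment estimates at fixed `u` feed that bound. For fixed `t`, `X_n(u,t)` is a sum of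
independent centred terms and `E X_n(u,t)^4 = O(δ_n²)`. For `t ≤ t'`, `E (X_n(u,t) - X_n(u,t'))^4 =
O((t'-t)²)` uniformly in the partition: on a common refinement of the two dilated partitions the
difference is a discrete stochastic integral, up to the single term `(W(u,t') - W(u,t))²`, and its
integrand is small on average (`exists_grid_sum_sq_sub`). Both estimates rest on
`integral_sum_pow_four_le`.

The supremum over `u` costs nothing: for fixed `t` and `t'` these quantities are martingales in `u`,
so Doob's inequality applies to their fourth powers. The supremum over `t` is taken by dyadic
chaining that starts at scale `2^(-l) ≈ δ_n`. The starting grid has about `1/δ_n` points, each of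
probability `O(δ_n²)`. At each finer level the number of increments times the squared spacing is
again `O(δ_n)`, with geometric decay. -/

/-! ### Moments of all orders and a fourth-moment bound for martingale-type sums. -/

/-- All absolute moments of the random variable `X` are finite. -/
def HasAllMoments {S : Type*} [MeasurableSpace S] (X : S → ℝ) (P : Measure S) : Prop :=
  ∀ p : ℝ≥0, MemLp X p P

namespace HasAllMoments

variable {S : Type*} [MeasurableSpace S] {P : Measure S} {X Y : S → ℝ}

theorem mul (hX : HasAllMoments X P) (hY : HasAllMoments Y P) :
    HasAllMoments (fun ω => X ω * Y ω) P := by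
  intro p
  have : ENNReal.HolderTriple ((2 * p : ℝ≥0) : ℝ≥0∞) ((2 * p : ℝ≥0) : ℝ≥0∞) (p : ℝ≥0∞) := by
    constructor
    rcases eq_or_ne p 0 with rfl | hp
    · simp
    · have hp' : (2 * p) ≠ 0 := by positivity
      rw [← ENNReal.coe_inv hp', ← ENNReal.coe_inv hp, ← ENNReal.coe_add]
      congr 1
      field_simp
      norm_num
  exact (hY (2 * p)).mul' (hX (2 * p))

theorem add (hX : HasAllMoments X P) (hY : HasAllMoments Y P) :
    HasAllMoments (fun ω => X ω + Y ω) P := fun p => (hX p).add (hY p)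

theorem sub (hX : HasAllMoments X P) (hY : HasAllMoments Y P) :
    HasAllMoments (fun ω => X ω - Y ω) P := fun p => (hX p).sub (hY p)

theorem const [IsFiniteMeasure P] (c : ℝ) : HasAllMoments (fun _ => c) P :=
  fun _ => memLp_const c

theorem const_mul (c : ℝ) (hX : HasAllMoments X P) :
    HasAllMoments (fun ω => c * X ω) P := fun p => (hX p).const_mul c

theorem pow [IsFiniteMeasure P] (hX : HasAllMoments X P) (n : ℕ) :
    HasAllMoments (fun ω => X ω ^ n) P := by
  induction n with
  | zero => simpa using const 1
  | succ n ih => simpa only [pow_succ] using ih.mul hX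

theorem sum {ι : Type*} (s : Finset ι) {Z : ι → S → ℝ} (hZ : ∀ i ∈ s, HasAllMoments (Z i) P) :
    HasAllMoments (fun ω => ∑ i ∈ s, Z i ω) P :=
  fun p => memLp_finsetSum s fun i hi => hZ i hi p

theorem indicator {A : Set S} (hA : MeasurableSet A) (hX : HasAllMoments X P) :
    HasAllMoments (A.indicator X) P := fun p => (hX p).indicator hA

theorem integrable (hX : HasAllMoments X P) : Integrable X P := by
  have := hX 1
  exact memLp_one_iff_integrable.1 (by simpa using this)

end HasAllMoments

theorem ProbabilityTheory.HasGaussianLaw.hasAllMoments {S : Type*} [MeasurableSpace S]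
    {P : Measure S} {X : S → ℝ} (hX : HasGaussianLaw X P) : HasAllMoments X P :=
  fun p => hX.memLp (by simp)

/-- The Cauchy–Schwarz inequality for integrals. -/
theorem integral_mul_le_sqrt_mul_sqrt {S : Type*} [MeasurableSpace S] {P : Measure S}
    {X Y : S → ℝ} (hX : Integrable (fun ω => X ω ^ 2) P) (hY : Integrable (fun ω => Y ω ^ 2) P)
    (hXY : Integrable (fun ω => X ω * Y ω) P) :
    ∫ ω, X ω * Y ω ∂P ≤ √(∫ ω, X ω ^ 2 ∂P) * √(∫ ω, Y ω ^ 2 ∂P) := by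
  have h : ∀ a b : ℝ, 0 ≤ (∫ ω, X ω ^ 2 ∂P) * (a * a) - 2 * a * b * (∫ ω, X ω * Y ω ∂P)
      + b * b * ∫ ω, Y ω ^ 2 ∂P := by
    intro a b
    have h1 : ∫ ω, (a * X ω - b * Y ω) ^ 2 ∂P = (∫ ω, X ω ^ 2 ∂P) * (a * a)
        - 2 * a * b * (∫ ω, X ω * Y ω ∂P) + b * b * ∫ ω, Y ω ^ 2 ∂P := by
      have i1 : Integrable (fun ω => a * a * X ω ^ 2 - 2 * a * b * (X ω * Y ω)) P :=
        (hX.const_mul _).sub (hXY.const_mul _)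
      rw [mul_comm _ (a * a), ← integral_const_mul, ← integral_const_mul, ← integral_const_mul,
        ← integral_sub (hX.const_mul _) (hXY.const_mul _),
        ← integral_add i1 (hY.const_mul _)]
      congr 1
      ext ω
      ring
    rw [← h1]
    exact integral_nonneg fun ω => sq_nonneg _
  have hd := discrim_le_zero (a := ∫ ω, X ω ^ 2 ∂P) (b := - 2 * ∫ ω, X ω * Y ω ∂P)
    (c := ∫ ω, Y ω ^ 2 ∂P) (fun a => by linarith [h a 1])
  have hX0 : 0 ≤ ∫ ω, X ω ^ 2 ∂P := integral_nonneg fun ω => sq_nonneg _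
  rw [← Real.sqrt_mul hX0]
  apply Real.le_sqrt_of_sq_le
  unfold discrim at hd
  linarith

/-- A fourth moment bound for sums whose increments satisfy the orthogonality relations of
martingale differences. -/
theorem integral_sum_pow_four_le {S : Type*} [MeasurableSpace S] {P : Measure S}
    [IsFiniteMeasure P] (D : ℕ → S → ℝ) (s : ℕ → ℝ) {K : ℝ} (hK : 0 ≤ K) (hs : ∀ i, 0 ≤ s i)
    (hD : ∀ i, HasAllMoments (D i) P)
    (h1 : ∀ i, ∫ ω, (∑ j ∈ Finset.range i, D j ω) * D i ω ^ 3 ∂P = 0)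
    (h3 : ∀ i, ∫ ω, (∑ j ∈ Finset.range i, D j ω) ^ 3 * D i ω ∂P = 0)
    (h4 : ∀ i, ∫ ω, D i ω ^ 4 ∂P ≤ K * s i ^ 2) (m : ℕ) :
    ∫ ω, (∑ j ∈ Finset.range m, D j ω) ^ 4 ∂P ≤ 9 * K * (∑ j ∈ Finset.range m, s j) ^ 2 := by
  induction m with
  | zero => simp
  | succ m ih =>
    set F : S → ℝ := fun ω => ∑ j ∈ Finset.range m, D j ω with hF
    have hFm : HasAllMoments F P := HasAllMoments.sum _ fun i _ => hD i
    have hDm := hD m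
    simp only [Finset.sum_range_succ]
    set T := ∑ j ∈ Finset.range m, s j with hT
    have hT0 : 0 ≤ T := Finset.sum_nonneg fun i _ => hs i
    have e1 : ∫ ω, (F ω + D m ω) ^ 4 ∂P = ∫ ω, F ω ^ 4 ∂P + 4 * ∫ ω, F ω ^ 3 * D m ω ∂P
        + 6 * ∫ ω, F ω ^ 2 * D m ω ^ 2 ∂P + 4 * ∫ ω, F ω * D m ω ^ 3 ∂P + ∫ ω, D m ω ^ 4 ∂P := by
      have i1 := (hFm.pow 4).integrable
      have i2 := (((hFm.pow 3).mul hDm).const_mul 4).integrable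
      have i3 := (((hFm.pow 2).mul (hDm.pow 2)).const_mul 6).integrable
      have i4 := ((hFm.mul (hDm.pow 3)).const_mul 4).integrable
      have i5 := (hDm.pow 4).integrable
      have j2 : Integrable (fun ω => F ω ^ 4 + 4 * (F ω ^ 3 * D m ω)) P := i1.add i2
      have j3 : Integrable (fun ω => F ω ^ 4 + 4 * (F ω ^ 3 * D m ω)
        + 6 * (F ω ^ 2 * D m ω ^ 2)) P := j2.add i3
      have j4 : Integrable (fun ω => F ω ^ 4 + 4 * (F ω ^ 3 * D m ω)
        + 6 * (F ω ^ 2 * D m ω ^ 2) + 4 * (F ω * D m ω ^ 3)) P := j3.add i4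
      rw [← integral_const_mul, ← integral_const_mul, ← integral_const_mul, ← integral_add i1 i2,
        ← integral_add j2 i3, ← integral_add j3 i4, ← integral_add j4 i5]
      congr 1
      ext ω
      ring
    have e2 : ∫ ω, F ω ^ 2 * D m ω ^ 2 ∂P ≤ 3 * K * T * s m := by
      have := integral_mul_le_sqrt_mul_sqrt (P := P) (X := fun ω => F ω ^ 2)
        (Y := fun ω => D m ω ^ 2) ((hFm.pow 2).pow 2).integrable ((hDm.pow 2).pow 2).integrable
        ((hFm.pow 2).mul (hDm.pow 2)).integrable
      simp only [← pow_mul] at this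
      refine this.trans ?_
      have a1 : √(∫ ω, F ω ^ (2 * 2) ∂P) ≤ 3 * √K * T := by
        rw [Real.sqrt_le_left (by positivity), mul_pow, mul_pow, Real.sq_sqrt hK]
        linarith
      have a2 : √(∫ ω, D m ω ^ (2 * 2) ∂P) ≤ √K * s m := by
        have := hs m
        rw [Real.sqrt_le_left (by positivity), mul_pow, Real.sq_sqrt hK]
        exact h4 m
      calc _ ≤ (3 * √K * T) * (√K * s m) := by gcongr
        _ = 3 * (√K * √K) * T * s m := by ring
        _ = _ := by rw [Real.mul_self_sqrt hK]
    have e3 := h1 m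
    have e4 := h3 m
    have e5 := h4 m
    rw [e1, e3, e4]
    -- The cross term contributes `6 * 3 = 18 = 2 * 9`, which is exactly the middle term of `9 * (T
    -- + s m) ^ 2`. This fixes the constant `9`, the least `A` with `6 * √A ≤ 2 * A`.
    have : 0 ≤ K * s m ^ 2 := by positivity
    nlinarith

theorem sub_pow_four_le (a b : ℝ) : (a - b) ^ 4 ≤ 8 * (a ^ 4 + b ^ 4) := by
  nlinarith [mul_nonneg (sq_nonneg (a + b)) (sq_nonneg (a - b)), sq_nonneg ((a + b) ^ 2),
    sq_nonneg (a + b), sq_nonneg (a ^ 2 - b ^ 2), sq_nonneg (a - b),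
    sq_nonneg (a ^ 2 + b ^ 2 + 6 * a * b)]

/-! ### Moments of centred Gaussian variables, by scaling from the standard one. -/

section GaussianMoments

/-- The `n`-th moment of the standard normal distribution. -/
noncomputable def gaussianMoment (n : ℕ) : ℝ := ∫ x, x ^ n ∂gaussianReal 0 1

variable {S : Type*} [MeasurableSpace S] {P : Measure S} {X : S → ℝ} {v : ℝ≥0}

theorem ProbabilityTheory.HasLaw.integral_pow_gaussianReal (hX : HasLaw X (gaussianReal 0 v) P)
    (n : ℕ) : ∫ ω, X ω ^ n ∂P = √v ^ n * gaussianMoment n := by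
  have h1 : gaussianReal 0 v = (gaussianReal 0 1).map (√v * ·) := by
    rw [gaussianReal_map_const_mul]
    congr 1
    · simp
    · ext; simp
  have h2 : ∫ ω, X ω ^ n ∂P = ∫ x, x ^ n ∂(gaussianReal 0 v) := by
    rw [← hX.map_eq, integral_map hX.aemeasurable (by fun_prop)]
  rw [h2, h1, integral_map (by fun_prop) (by fun_prop)]
  simp only [mul_pow, integral_const_mul, gaussianMoment]

theorem gaussianMoment_eq_zero_of_odd {n : ℕ} (hn : Odd n) : gaussianMoment n = 0 := by
  have h : gaussianMoment n = - gaussianMoment n := by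
    conv_lhs => rw [gaussianMoment, ← neg_zero (G := ℝ), ← gaussianReal_map_neg,
      integral_map (by fun_prop) (by fun_prop)]
    simp only [hn.neg_pow, integral_neg, gaussianMoment]
  linarith

theorem gaussianMoment_nonneg_of_even {n : ℕ} (hn : Even n) : 0 ≤ gaussianMoment n :=
  integral_nonneg fun _ => hn.pow_nonneg _

theorem ProbabilityTheory.HasLaw.integral_pow_four_gaussianReal
    (hX : HasLaw X (gaussianReal 0 v) P) : ∫ ω, X ω ^ 4 ∂P = gaussianMoment 4 * v ^ 2 := by
  rw [hX.integral_pow_gaussianReal, show √(v : ℝ) ^ 4 = (√v ^ 2) ^ 2 by ring,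
    Real.sq_sqrt v.coe_nonneg, mul_comm]

theorem ProbabilityTheory.HasLaw.integral_pow_odd_gaussianReal
    (hX : HasLaw X (gaussianReal 0 v) P) {n : ℕ} (hn : Odd n) : ∫ ω, X ω ^ n ∂P = 0 := by
  rw [hX.integral_pow_gaussianReal, gaussianMoment_eq_zero_of_odd hn, mul_zero]

theorem gaussianMoment_two : gaussianMoment 2 = 1 := by
  have := variance_fun_id_gaussianReal (μ := 0) (v := 1)
  rw [variance_eq_integral (by fun_prop)] at this
  simpa [gaussianMoment, integral_id_gaussianReal] using this

theorem ProbabilityTheory.HasLaw.integral_sq_gaussianReal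
    (hX : HasLaw X (gaussianReal 0 v) P) : ∫ ω, X ω ^ 2 ∂P = v := by
  rw [hX.integral_pow_gaussianReal, Real.sq_sqrt v.coe_nonneg, gaussianMoment_two, mul_one]

theorem ProbabilityTheory.HasLaw.integral_sq_sub_pow_four_le [IsFiniteMeasure P]
    (hX : HasLaw X (gaussianReal 0 v) P) (hXm : HasAllMoments X P) :
    ∫ ω, (X ω ^ 2 - v) ^ 4 ∂P ≤ 8 * (gaussianMoment 8 + P.real Set.univ) * v ^ 4 := by
  have h8 : ∫ ω, X ω ^ 8 ∂P = gaussianMoment 8 * v ^ 4 := by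
    rw [hX.integral_pow_gaussianReal, show √(v : ℝ) ^ 8 = (√v ^ 2) ^ 4 by ring,
      Real.sq_sqrt v.coe_nonneg, mul_comm]
  have i8 := (hXm.pow 8).integrable
  calc ∫ ω, (X ω ^ 2 - v) ^ 4 ∂P ≤ ∫ ω, 8 * (X ω ^ 8 + v ^ 4) ∂P := by
        refine integral_mono (((hXm.pow 2).sub (.const _)).pow 4).integrable
          ((i8.add (integrable_const _)).const_mul 8) fun ω => ?_
        have := sub_pow_four_le (X ω ^ 2) v
        simpa [← pow_mul] using this
    _ = _ := by
        rw [integral_const_mul, integral_add i8 (integrable_const _), h8, integral_const]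
        simp only [smul_eq_mul]
        ring

end GaussianMoments

/-! ### Deterministic comparison of two dilated partitions. -/

/-- The largest of the points `a 0, …, a K` that is at most `r` (and `0` if there is none). -/
noncomputable def floorAlong (a : ℕ → ℝ≥0) (K : ℕ) (r : ℝ≥0) : ℝ≥0 :=
  ((Finset.range (K + 1)).filter fun j => a j ≤ r).sup a

theorem floorAlong_le (a : ℕ → ℝ≥0) (K : ℕ) (r : ℝ≥0) : floorAlong a K r ≤ r :=
  Finset.sup_le fun _ hj => (Finset.mem_filter.1 hj).2

theorem le_floorAlong {a : ℕ → ℝ≥0} {K j : ℕ} {r : ℝ≥0} (hj : j ≤ K) (hr : a j ≤ r) :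
    a j ≤ floorAlong a K r :=
  Finset.le_sup (f := a) (Finset.mem_filter.2 ⟨Finset.mem_range.2 (by omega), hr⟩)

theorem floorAlong_eq {a : ℕ → ℝ≥0} (ha : Monotone a) {K j : ℕ} {r : ℝ≥0} (hj : j ≤ K)
    (hr : a j ≤ r) (hr' : r < a (j + 1)) : floorAlong a K r = a j := by
  refine le_antisymm (Finset.sup_le fun i hi => ha ?_) (le_floorAlong hj hr)
  by_contra! h
  exact absurd ((ha (Nat.succ_le_of_lt h)).trans (Finset.mem_filter.1 hi).2) (not_le.2 hr')

/-- Increments `H (a j) (a (j + 1)) - H (a j) (a j)` along a partition `a` as a telescoping sum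
along a finer grid `c`. -/
theorem sum_floorAlong_sub {a c : ℕ → ℝ≥0} (ha : Monotone a) (hc : StrictMono c) {K : ℕ}
    {m : ℕ → ℕ} (hm : ∀ j ≤ K, c (m j) = a j) (hm0 : m 0 = 0) (H : ℝ≥0 → ℝ≥0 → ℝ) :
    ∑ i ∈ Finset.range (m K), (H (floorAlong a K (c i)) (c (i + 1)) - H (floorAlong a K (c i)) (c i))
      = ∑ j ∈ Finset.range K, (H (a j) (a (j + 1)) - H (a j) (a j)) := by
  suffices h : ∀ L ≤ K, ∑ i ∈ Finset.range (m L),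
      (H (floorAlong a K (c i)) (c (i + 1)) - H (floorAlong a K (c i)) (c i))
      = ∑ j ∈ Finset.range L, (H (a j) (a (j + 1)) - H (a j) (a j)) from h K le_rfl
  intro L
  induction L with
  | zero => simp [hm0]
  | succ L ih =>
    intro hL
    have hle : m L ≤ m (L + 1) := by
      rw [← hc.le_iff_le, hm L (by omega), hm (L + 1) hL]
      exact ha (Nat.le_succ L)
    rw [Finset.sum_range_succ, ← ih (by omega), ← Finset.sum_range_add_sum_Ico _ hle]
    congr 1
    have h1 : ∀ i ∈ Finset.Ico (m L) (m (L + 1)),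
        (H (floorAlong a K (c i)) (c (i + 1)) - H (floorAlong a K (c i)) (c i))
        = H (a L) (c (i + 1)) - H (a L) (c i) := by
      intro i hi
      rw [Finset.mem_Ico] at hi
      rw [floorAlong_eq ha (show L ≤ K by omega)]
      · rw [← hm L (by omega)]; exact hc.monotone hi.1
      · rw [← hm (L + 1) hL]; exact hc hi.2
    rw [Finset.sum_congr rfl h1, Finset.sum_Ico_sub (fun i => H (a L) (c i)) hle, hm L (by omega),
      hm (L + 1) hL]

/-- Every finite set of nonnegative reals lies on a strictly increasing sequence from `0`. -/
theorem exists_strictMono_forall_mem_range (C : Finset ℝ≥0) :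
    ∃ c : ℕ → ℝ≥0, StrictMono c ∧ c 0 = 0 ∧ ∀ x ∈ C, ∃ i, c i = x := by
  classical
  set C' := insert 0 C with hC'
  have hpos : 0 < C'.card := Finset.card_pos.2 ⟨0, Finset.mem_insert_self 0 C⟩
  set e := C'.orderEmbOfFin rfl with he
  -- Past the largest point of the set the sequence continues arbitrarily, staying strictly above
  -- its maximum.
  refine ⟨fun i => if h : i < C'.card then e ⟨i, h⟩ else C'.sup id + 1 + i,
    strictMono_nat_of_lt_succ ?_, ?_, ?_⟩
  · intro i
    by_cases h2 : i < C'.card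
    · by_cases h1 : i + 1 < C'.card
      · simp only [h1, h2, dif_pos]
        exact e.strictMono (Fin.mk_lt_mk.2 (Nat.lt_succ_self i))
      · simp only [h1, h2, dif_pos, dif_neg, not_false_eq_true]
        have h3 : e ⟨i, h2⟩ ≤ C'.sup id :=
          Finset.le_sup (f := id) (C'.orderEmbOfFin_mem rfl ⟨i, h2⟩)
        have h4 : C'.sup id < C'.sup id + 1 := lt_add_one _
        exact (h3.trans_lt h4).trans_le le_self_add
    · have h1 : ¬ i + 1 < C'.card := by omega
      simp only [h1, h2, dif_neg, not_false_eq_true]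
      gcongr
      omega
  · obtain ⟨i, hi⟩ : (0 : ℝ≥0) ∈ Set.range e := by
      rw [he, Finset.range_orderEmbOfFin]
      exact Finset.mem_insert_self 0 C
    have : e ⟨0, hpos⟩ ≤ e i := e.monotone (Nat.zero_le _)
    simp only [hpos, dif_pos]
    exact le_antisymm (this.trans hi.le) zero_le
  · intro x hx
    obtain ⟨i, hi⟩ : x ∈ Set.range e := by
      rw [he, Finset.range_orderEmbOfFin]
      exact Finset.mem_insert_of_mem hx
    exact ⟨i, by simp [hi]⟩

/-- Comparison of the sums of squared increments along two dilations of a partition `p`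
of `[0, 1]`, written as a sum over the increments along a common refinement `c`. -/
theorem exists_grid_sum_sq_sub {p : ℕ → ℝ≥0} (hp : Monotone p) {k : ℕ} (hp0 : p 0 = 0)
    (hp1 : p k = 1) {t t' : ℝ≥0} (htt' : t ≤ t') (ht' : t' ≤ 1) :
    ∃ (c y z : ℕ → ℝ≥0) (N : ℕ), Monotone c ∧ (∀ i, y i ≤ c i) ∧ (∀ i, z i ≤ c i) ∧
      (∑ i ∈ Finset.range N, ((c (i + 1) : ℝ) - c i) * |(z i : ℝ) - y i| ≤ 3 * ((t' : ℝ) - t)) ∧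
      ∀ w : ℝ≥0 → ℝ,
        ∑ j ∈ Finset.range k, (w (t * p (j + 1)) - w (t * p j)) ^ 2 + (w t' - w t) ^ 2
          - ∑ j ∈ Finset.range k, (w (t' * p (j + 1)) - w (t' * p j)) ^ 2
        = ∑ i ∈ Finset.range N, 2 * ((w (c (i + 1)) - w (c i)) * (w (z i) - w (y i))) := by
  classical
  -- The extra point `t'` after `t * p k = t` makes both grids end at `t'`; its cell `[t, t']`
  -- produces the term `(w t' - w t) ^ 2`.
  set a : ℕ → ℝ≥0 := fun j => if j ≤ k then t * p j else t' with ha_def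
  set b : ℕ → ℝ≥0 := fun j => t' * p j with hb_def
  have hpk : ∀ j ≤ k, p j ≤ 1 := fun j hj => hp1 ▸ hp hj
  have ha : Monotone a := by
    refine monotone_nat_of_le_succ fun j => ?_
    by_cases h1 : j + 1 ≤ k
    · simp only [ha_def, h1, show j ≤ k by omega, if_true]
      gcongr
      exact hp (Nat.le_succ j)
    · by_cases h2 : j ≤ k
      · simp only [ha_def, h1, h2, if_true, if_false]
        calc t * p j ≤ t * 1 := by gcongr; exact hpk j h2
          _ ≤ t' := by simpa using htt'
      · simp only [ha_def, h1, h2, if_false, le_refl]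
  have hb : Monotone b := fun i j hij => by
    simp only [hb_def]
    gcongr
    exact hp hij
  obtain ⟨c, hc, hc0, hcC⟩ := exists_strictMono_forall_mem_range
    ((Finset.range (k + 2)).image a ∪ (Finset.range (k + 1)).image b)
  have hma : ∀ j, ∃ i, j ≤ k + 1 → c i = a j := fun j => by
    by_cases h : j ≤ k + 1
    · obtain ⟨i, hi⟩ := hcC (a j) (Finset.mem_union_left _
        (Finset.mem_image_of_mem a (Finset.mem_range.2 (by omega))))
      exact ⟨i, fun _ => hi⟩
    · exact ⟨0, fun h' => absurd h' h⟩
  have hmb : ∀ j, ∃ i, j ≤ k → c i = b j := fun j => by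
    by_cases h : j ≤ k
    · obtain ⟨i, hi⟩ := hcC (b j) (Finset.mem_union_right _
        (Finset.mem_image_of_mem b (Finset.mem_range.2 (by omega))))
      exact ⟨i, fun _ => hi⟩
    · exact ⟨0, fun h' => absurd h' h⟩
  choose ma hma using hma
  choose mb hmb using hmb
  have ha0 : a 0 = 0 := by simp [ha_def, hp0]
  have hb0 : b 0 = 0 := by simp [hb_def, hp0]
  have hma0 : ma 0 = 0 := hc.injective (by rw [hma 0 (by omega), ha0, hc0])
  have hmb0 : mb 0 = 0 := hc.injective (by rw [hmb 0 (by omega), hb0, hc0])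
  have hak : a k = t := by simp [ha_def, hp1]
  have hak1 : a (k + 1) = t' := by simp [ha_def]
  have hbk : b k = t' := by simp [hb_def, hp1]
  set N := ma (k + 1) with hN
  have hcN : c N = t' := by rw [hN, hma _ le_rfl, hak1]
  have hmbk : mb k = N := hc.injective (by rw [hmb k le_rfl, hbk, hcN])
  have Ha : ∀ H : ℝ≥0 → ℝ≥0 → ℝ, ∑ i ∈ Finset.range N, (H (floorAlong a (k + 1) (c i)) (c (i + 1))
      - H (floorAlong a (k + 1) (c i)) (c i))
      = ∑ j ∈ Finset.range k, (H (t * p j) (t * p (j + 1)) - H (t * p j) (t * p j))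
        + (H t t' - H t t) := fun H => by
    rw [hN, sum_floorAlong_sub ha hc hma hma0, Finset.sum_range_succ, hak, hak1]
    congr 1
    refine Finset.sum_congr rfl fun j hj => ?_
    rw [Finset.mem_range] at hj
    simp only [ha_def, show j ≤ k by omega, show j + 1 ≤ k by omega, if_true]
  have Hb : ∀ H : ℝ≥0 → ℝ≥0 → ℝ, ∑ i ∈ Finset.range N, (H (floorAlong b k (c i)) (c (i + 1))
      - H (floorAlong b k (c i)) (c i))
      = ∑ j ∈ Finset.range k, (H (t' * p j) (t' * p (j + 1)) - H (t' * p j) (t' * p j)) :=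
    fun H => by rw [← hmbk, sum_floorAlong_sub hb hc hmb hmb0]
  refine ⟨c, fun i => floorAlong a (k + 1) (c i), fun i => floorAlong b k (c i), N, hc.monotone,
    fun i => floorAlong_le _ _ _, fun i => floorAlong_le _ _ _, ?_, fun w => ?_⟩
  · have hfl : ∀ r, (floorAlong b k r : ℝ) ≤ floorAlong a (k + 1) r + ((t' : ℝ) - t) := by
      intro r
      have htt : (t' : ℝ) - t = ((t' - t : ℝ≥0) : ℝ) := by rw [NNReal.coe_sub htt']
      rw [htt]
      norm_cast
      refine Finset.sup_le fun j hj => ?_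
      obtain ⟨hj1, hj2⟩ := Finset.mem_filter.1 hj
      have hjk : j ≤ k := by rw [Finset.mem_range] at hj1; omega
      have haj : a j = t * p j := if_pos hjk
      have h1 : a j ≤ floorAlong a (k + 1) r := by
        refine le_floorAlong (by omega) (le_trans ?_ hj2)
        rw [haj]
        simp only [hb_def]
        gcongr
      calc b j = a j + (t' - t) * p j := by
            rw [haj, ← add_mul, add_tsub_cancel_of_le htt']
        _ ≤ floorAlong a (k + 1) r + (t' - t) * 1 := by gcongr; exact hpk j hjk
        _ = _ := by rw [mul_one]
    have htr : (t : ℝ) ≤ t' := htt'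
    -- Since `z ≤ y + (t' - t)`, the absolute value is dominated by a signed difference plus a
    -- constant. The signed part can then be summed exactly.
    have h1 : ∀ i, |(floorAlong b k (c i) : ℝ) - floorAlong a (k + 1) (c i)| ≤
        (floorAlong a (k + 1) (c i) : ℝ) - floorAlong b k (c i) + 2 * ((t' : ℝ) - t) := fun i => by
      have := hfl (c i)
      rw [abs_le]
      constructor <;> linarith
    set Sp : ℝ := ∑ j ∈ Finset.range k, (p j : ℝ) * ((p (j + 1) : ℝ) - p j) with hSp
    have hSp0 : 0 ≤ Sp := Finset.sum_nonneg fun j _ =>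
      mul_nonneg (p j).2 (sub_nonneg.2 (NNReal.coe_le_coe.2 (hp (Nat.le_succ j))))
    -- With `H x r = x * r` the telescoping identity evaluates `∑ (c (i + 1) - c i) * y i` in closed
    -- form, and likewise for `z`. The two results differ by at most `t * (t' - t)`, whatever the
    -- partition.
    have hya := Ha fun x r => (x : ℝ) * r
    have hzb := Hb fun x r => (x : ℝ) * r
    have hga : ∑ j ∈ Finset.range k, ((fun x r : ℝ≥0 => (x : ℝ) * r) (t * p j) (t * p (j + 1))
        - (fun x r : ℝ≥0 => (x : ℝ) * r) (t * p j) (t * p j)) = (t : ℝ) ^ 2 * Sp := by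
      rw [hSp, Finset.mul_sum]
      refine Finset.sum_congr rfl fun j _ => ?_
      push_cast
      ring
    have hgb : ∑ j ∈ Finset.range k, ((fun x r : ℝ≥0 => (x : ℝ) * r) (t' * p j) (t' * p (j + 1))
        - (fun x r : ℝ≥0 => (x : ℝ) * r) (t' * p j) (t' * p j)) = (t' : ℝ) ^ 2 * Sp := by
      rw [hSp, Finset.mul_sum]
      refine Finset.sum_congr rfl fun j _ => ?_
      push_cast
      ring
    rw [hga] at hya
    rw [hgb] at hzb
    have hcs : ∑ i ∈ Finset.range N, ((c (i + 1) : ℝ) - c i) = t' := by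
      rw [Finset.sum_range_sub (fun i => (c i : ℝ)), hcN, hc0]
      simp
    have ht'1 : (t' : ℝ) ≤ 1 := ht'
    have ht0 : (0 : ℝ) ≤ t := t.2
    calc ∑ i ∈ Finset.range N, ((c (i + 1) : ℝ) - c i)
          * |(floorAlong b k (c i) : ℝ) - floorAlong a (k + 1) (c i)|
        ≤ ∑ i ∈ Finset.range N, ((c (i + 1) : ℝ) - c i) *
          ((floorAlong a (k + 1) (c i) : ℝ) - floorAlong b k (c i) + 2 * ((t' : ℝ) - t)) := by
          refine Finset.sum_le_sum fun i _ => mul_le_mul_of_nonneg_left (h1 i) ?_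
          exact sub_nonneg.2 (NNReal.coe_le_coe.2 (hc.monotone (Nat.le_succ i)))
      _ = ((t : ℝ) ^ 2 * Sp + (t * t' - t * t)) - (t' : ℝ) ^ 2 * Sp + 2 * ((t' : ℝ) - t) * t' := by
          rw [← hya, ← hzb, ← hcs, ← Finset.sum_sub_distrib, Finset.mul_sum,
            ← Finset.sum_add_distrib]
          refine Finset.sum_congr rfl fun i _ => ?_
          simp only [hcs]
          ring
      _ ≤ 3 * ((t' : ℝ) - t) := by
          have h2 : (t : ℝ) ^ 2 * Sp ≤ (t' : ℝ) ^ 2 * Sp := by gcongr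
          nlinarith [mul_nonneg (sub_nonneg.2 htr) (sub_nonneg.2 ht'1),
            mul_nonneg (sub_nonneg.2 htr) (sub_nonneg.2 (htr.trans ht'1))]
  · have hya := Ha fun x r => (w r - w x) ^ 2
    have hzb := Hb fun x r => (w r - w x) ^ 2
    simp only [sub_self, ne_eq, OfNat.ofNat_ne_zero, not_false_eq_true, zero_pow, sub_zero]
      at hya hzb
    rw [← hya, ← hzb, ← Finset.sum_sub_distrib]
    refine Finset.sum_congr rfl fun i _ => ?_
    ring

/-! ### Gaussian sheets and independence of increments. -/

/-- A real Gaussian process indexed by the quadrant with measurable coordinates and the mean and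
covariance of the Brownian sheet; no path regularity is assumed. -/
structure IsPreSheet {S : Type*} [MeasurableSpace S] (P : Measure S)
    (B : ℝ≥0 × ℝ≥0 → S → ℝ) : Prop where
  gaussian : IsGaussianProcess B P
  measurable : ∀ p, Measurable (B p)
  centered : ∀ p, ∫ ω, B p ω ∂P = 0
  covariance : ∀ p q, cov[B p, B q; P] = ((min p.1 q.1 * min p.2 q.2 : ℝ≥0) : ℝ)

/-- The σ-algebra generated by the coordinates of `B` in `T`. -/
abbrev coordSigma {ι S : Type*} (B : ι → S → ℝ) (T : Set ι) : MeasurableSpace S :=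
  MeasurableSpace.comap (fun ω (p : T) => B p ω) inferInstance

theorem measurable_coordSigma {ι S : Type*} (B : ι → S → ℝ) {T : Set ι} {p : ι} (hp : p ∈ T) :
    Measurable[coordSigma B T] (B p) :=
  (measurable_pi_apply (⟨p, hp⟩ : T)).comp (comap_measurable (fun ω (p : T) => B p ω))

theorem coordSigma_le {ι S : Type*} [mS : MeasurableSpace S] {B : ι → S → ℝ}
    (hB : ∀ p, Measurable (B p)) (T : Set ι) : coordSigma B T ≤ mS :=
  Measurable.comap_le (measurable_pi_lambda _ fun p => hB p)

theorem coordSigma_mono {ι S : Type*} (B : ι → S → ℝ) {T T' : Set ι} (h : T ⊆ T') :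
    coordSigma B T ≤ coordSigma B T' := by
  refine Measurable.comap_le ?_
  rw [@measurable_pi_iff]
  exact fun p => measurable_coordSigma B (h p.2)

namespace IsPreSheet

variable {S : Type*} [MeasurableSpace S] {P : Measure S} {B : ℝ≥0 × ℝ≥0 → S → ℝ}

theorem isProbabilityMeasure (hB : IsPreSheet P B) : IsProbabilityMeasure P :=
  hB.gaussian.isProbabilityMeasure

theorem hasAllMoments (hB : IsPreSheet P B) (p : ℝ≥0 × ℝ≥0) : HasAllMoments (B p) P :=
  (hB.gaussian.hasGaussianLaw_eval p).hasAllMoments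

theorem memLp_two (hB : IsPreSheet P B) (p : ℝ≥0 × ℝ≥0) : MemLp (B p) 2 P :=
  hB.hasAllMoments p 2

theorem hasAllMoments_sub (hB : IsPreSheet P B) (p q : ℝ≥0 × ℝ≥0) :
    HasAllMoments (fun ω => B p ω - B q ω) P :=
  (hB.hasAllMoments p).sub (hB.hasAllMoments q)

theorem covariance_sub (hB : IsPreSheet P B) (p q r : ℝ≥0 × ℝ≥0) :
    cov[B p, fun ω => B q ω - B r ω; P] =
      ((min p.1 q.1 * min p.2 q.2 : ℝ≥0) : ℝ) - ((min p.1 r.1 * min p.2 r.2 : ℝ≥0) : ℝ) := by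
  have := hB.isProbabilityMeasure
  rw [← hB.covariance p q, ← hB.covariance p r]
  exact covariance_fun_sub_right (hB.memLp_two p) (hB.memLp_two q) (hB.memLp_two r)

theorem hasLaw_sub (hB : IsPreSheet P B) (u : ℝ≥0) {s t : ℝ≥0} (hst : s ≤ t) :
    HasLaw (fun ω => B (u, t) ω - B (u, s) ω) (gaussianReal 0 (u * (t - s))) P := by
  have := hB.isProbabilityMeasure
  have hg : HasGaussianLaw (fun ω => B (u, t) ω - B (u, s) ω) P :=
    hB.gaussian.hasGaussianLaw_fun_sub
  refine ⟨hg.aemeasurable, ?_⟩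
  rw [hg.map_eq_gaussianReal]
  congr 1
  · rw [integral_sub (hB.hasAllMoments _).integrable (hB.hasAllMoments _).integrable,
      hB.centered, hB.centered, sub_zero]
  · have h1 : Var[fun ω => B (u, t) ω - B (u, s) ω; P] = ((u * (t - s) : ℝ≥0) : ℝ) := by
      rw [← covariance_self hg.aemeasurable,
        covariance_fun_sub_left (hB.memLp_two _) (hB.memLp_two _)
          (hB.hasAllMoments_sub _ _ 2), hB.covariance_sub, hB.covariance_sub]
      simp only [min_self, min_eq_left hst, min_eq_right hst]
      rw [NNReal.coe_mul, NNReal.coe_mul, NNReal.coe_mul, NNReal.coe_sub hst]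
      ring
    rw [h1, Real.toNNReal_coe]

/-- The hypothesis `h` says that each `B p` with `p ∈ T` has the same covariance with `B (q i)` as
with `B (r i)`. The increments are thus uncorrelated with the coordinates in `T`, and joint
Gaussianity turns this into independence of the whole families. -/
theorem indepFun_sub (hB : IsPreSheet P B) {ι : Type*} (T : Set (ℝ≥0 × ℝ≥0))
    (q r : ι → ℝ≥0 × ℝ≥0)
    (h : ∀ p ∈ T, ∀ i, min p.1 (q i).1 * min p.2 (q i).2 = min p.1 (r i).1 * min p.2 (r i).2) :
    IndepFun (fun ω (p : T) => B p ω) (fun ω i => B (q i) ω - B (r i) ω) P := by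
  classical
  refine IsGaussianProcess.indepFun_of_covariance_eq_zero (X := fun (p : T) ω => B p ω)
    (Y := fun i ω => B (q i) ω - B (r i) ω) ?_ (fun p => (hB.measurable p).aemeasurable)
    (fun i => ((hB.measurable _).sub (hB.measurable _)).aemeasurable) fun p i => ?_
  · refine hB.gaussian.of_isGaussianProcess fun s => ?_
    rcases s with p | i
    · exact ⟨{p.1}, ContinuousLinearMap.proj ⟨p.1, by simp⟩, fun ω => by simp⟩
    · exact ⟨{q i, r i}, ContinuousLinearMap.proj ⟨q i, by simp⟩
        - ContinuousLinearMap.proj ⟨r i, by simp⟩, fun ω => by simp⟩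
  · have := hB.covariance_sub p (q i) (r i)
    rw [h p p.2 i, sub_self] at this
    exact this

theorem integral_mul_eq_mul_integral (hB : IsPreSheet P B) {ι : Type*} {T : Set (ℝ≥0 × ℝ≥0)}
    {q r : ι → ℝ≥0 × ℝ≥0}
    (h : ∀ p ∈ T, ∀ i, min p.1 (q i).1 * min p.2 (q i).2 = min p.1 (r i).1 * min p.2 (r i).2)
    {F : S → ℝ} (hF : Measurable[coordSigma B T] F) {g : (ι → ℝ) → ℝ} (hg : Measurable g) :
    ∫ ω, F ω * g (fun i => B (q i) ω - B (r i) ω) ∂P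
      = (∫ ω, F ω ∂P) * ∫ ω, g (fun i => B (q i) ω - B (r i) ω) ∂P := by
  have hi := hB.indepFun_sub T q r h
  have h2 : IndepFun F (fun ω => g (fun i => B (q i) ω - B (r i) ω)) P := by
    rw [IndepFun_iff_Indep] at hi ⊢
    refine indep_of_indep_of_le_left (indep_of_indep_of_le_right hi ?_) hF.comap_le
    exact Measurable.comap_le (hg.comp (comap_measurable _))
  refine h2.integral_fun_mul_eq_mul_integral
    (hF.mono (coordSigma_le hB.measurable T) le_rfl).aestronglyMeasurable
    (Measurable.aestronglyMeasurable ?_)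
  exact hg.comp (measurable_pi_lambda _ fun i => (hB.measurable _).sub (hB.measurable _))

/-- Increments in the second parameter are independent of the past in that parameter. -/
theorem integral_mul_increment (hB : IsPreSheet P B) (u : ℝ≥0) {s t : ℝ≥0} (hst : s ≤ t)
    {F : S → ℝ} (hF : Measurable[coordSigma B {p | p.2 ≤ s}] F) {g : ℝ → ℝ} (hg : Measurable g) :
    ∫ ω, F ω * g (B (u, t) ω - B (u, s) ω) ∂P
      = (∫ ω, F ω ∂P) * ∫ ω, g (B (u, t) ω - B (u, s) ω) ∂P := by
  refine hB.integral_mul_eq_mul_integral (ι := Unit) (q := fun _ => (u, t)) (r := fun _ => (u, s))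
    (fun p hp _ => ?_) hF (g := fun x => g (x ())) (hg.comp (measurable_pi_apply _))
  have hp' : p.2 ≤ s := hp
  rw [min_eq_left hp', min_eq_left (hp'.trans hst)]

/-- Increments in the first parameter are independent of the past in that parameter. -/
theorem integral_mul_increments (hB : IsPreSheet P B) {u v : ℝ≥0} (huv : u ≤ v)
    {F : S → ℝ} (hF : Measurable[coordSigma B {p | p.1 ≤ u}] F) {g : (ℝ≥0 → ℝ) → ℝ}
    (hg : Measurable g) :
    ∫ ω, F ω * g (fun y => B (v, y) ω - B (u, y) ω) ∂P
      = (∫ ω, F ω ∂P) * ∫ ω, g (fun y => B (v, y) ω - B (u, y) ω) ∂P := by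
  refine hB.integral_mul_eq_mul_integral (ι := ℝ≥0) (q := fun y => (v, y)) (r := fun y => (u, y))
    (fun p hp _ => ?_) hF hg
  have hp' : p.1 ≤ u := hp
  rw [min_eq_left hp', min_eq_left (hp'.trans huv)]

end IsPreSheet

/-! ### Fourth moments of sums of squared increments at a fixed level. -/

/-- The sum of the squared increments of `w` along the dilation by `t` of the partition `p`. -/
noncomputable def quadVar (p : ℕ → ℝ≥0) (k : ℕ) (w : ℝ≥0 → ℝ) (t : ℝ≥0) : ℝ :=
  ∑ j ∈ Finset.range k, (w (t * p (j + 1)) - w (t * p j)) ^ 2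

/-- `p 0 = 0 ≤ p 1 ≤ ⋯ ≤ p k = 1` is a partition of `[0, 1]` with mesh at most `δ`. -/
structure IsPartitionSeq (p : ℕ → ℝ≥0) (k : ℕ) (δ : ℝ) : Prop where
  mono : Monotone p
  zero : p 0 = 0
  one : p k = 1
  le : ∀ j < k, (p (j + 1) : ℝ) - p j ≤ δ

/-- The constant in the fourth moment bound for centred squares of Gaussian variables. -/
noncomputable def sqConst : ℝ := 8 * (gaussianMoment 8 + 1)

theorem sqConst_nonneg : 0 ≤ sqConst :=
  mul_nonneg (by norm_num) (add_nonneg (gaussianMoment_nonneg_of_even (by decide)) zero_le_one)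

namespace IsPreSheet

variable {S : Type*} [MeasurableSpace S] {P : Measure S} {B : ℝ≥0 × ℝ≥0 → S → ℝ}

theorem integral_centred_sq_pow_four_le (hB : IsPreSheet P B) (u : ℝ≥0) {s t : ℝ≥0}
    (hst : s ≤ t) :
    ∫ ω, ((B (u, t) ω - B (u, s) ω) ^ 2 - u * ((t : ℝ) - s)) ^ 4 ∂P
      ≤ sqConst * (u * ((t : ℝ) - s)) ^ 4 := by
  have := hB.isProbabilityMeasure
  have h := (hB.hasLaw_sub u hst).integral_sq_sub_pow_four_le (hB.hasAllMoments_sub _ _)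
  simpa [NNReal.coe_sub hst, sqConst] using h

theorem integral_centred_sq (hB : IsPreSheet P B) (u : ℝ≥0) {s t : ℝ≥0} (hst : s ≤ t) :
    ∫ ω, ((B (u, t) ω - B (u, s) ω) ^ 2 - u * ((t : ℝ) - s)) ∂P = 0 := by
  have := hB.isProbabilityMeasure
  rw [integral_sub ((hB.hasAllMoments_sub _ _).pow 2).integrable (integrable_const _),
    (hB.hasLaw_sub u hst).integral_sq_gaussianReal]
  simp [NNReal.coe_sub hst]

theorem integral_sub_pow_four (hB : IsPreSheet P B) (u s t : ℝ≥0) :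
    ∫ ω, (B (u, t) ω - B (u, s) ω) ^ 4 ∂P = gaussianMoment 4 * (u * |(t : ℝ) - s|) ^ 2 := by
  rcases le_total s t with h | h
  · rw [(hB.hasLaw_sub u h).integral_pow_four_gaussianReal,
      abs_of_nonneg (sub_nonneg.2 (NNReal.coe_le_coe.2 h)), NNReal.coe_mul, NNReal.coe_sub h]
  · rw [abs_sub_comm, abs_of_nonneg (sub_nonneg.2 (NNReal.coe_le_coe.2 h)), ← NNReal.coe_sub h,
      ← NNReal.coe_mul, ← (hB.hasLaw_sub u h).integral_pow_four_gaussianReal]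
    congr 1
    ext ω
    ring

theorem hasAllMoments_centred_sq (hB : IsPreSheet P B) (p q : ℝ≥0 × ℝ≥0) (c : ℝ) :
    HasAllMoments (fun ω => (B p ω - B q ω) ^ 2 - c) P := by
  have := hB.isProbabilityMeasure
  exact ((hB.hasAllMoments_sub _ _).pow 2).sub (.const _)

/-- Fourth moment of the deviation of the sum of squared increments from its mean. -/
theorem integral_quadVar_sub_pow_four_le (hB : IsPreSheet P B) (u t : ℝ≥0) {p : ℕ → ℝ≥0}
    {k : ℕ} {δ : ℝ} (hp : IsPartitionSeq p k δ) :
    ∫ ω, (quadVar p k (fun r => B (u, r) ω) t - u * t) ^ 4 ∂P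
      ≤ 9 * sqConst * ((u * t) ^ 2 * δ) ^ 2 := by
  have := hB.isProbabilityMeasure
  have hmono : ∀ j, t * p j ≤ t * p (j + 1) := fun j => by
    gcongr
    exact hp.mono (Nat.le_succ j)
  set D : ℕ → S → ℝ := fun j ω => (B (u, t * p (j + 1)) ω - B (u, t * p j) ω) ^ 2
    - u * (((t * p (j + 1) : ℝ≥0) : ℝ) - ((t * p j : ℝ≥0) : ℝ)) with hD
  set s : ℕ → ℝ := fun j => (u * (((t * p (j + 1) : ℝ≥0) : ℝ) - ((t * p j : ℝ≥0) : ℝ))) ^ 2 with hs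
  have hDm : ∀ j, HasAllMoments (D j) P := fun j => hB.hasAllMoments_centred_sq _ _ _
  have hD0 : ∀ j, ∫ ω, D j ω ∂P = 0 := fun j => hB.integral_centred_sq u (hmono j)
  have hF : ∀ i, Measurable[coordSigma B {q | q.2 ≤ t * p i}]
      (fun ω => ∑ j ∈ Finset.range i, D j ω) := fun i => by
    refine Finset.measurable_fun_sum _ fun j hj => ?_
    rw [Finset.mem_range] at hj
    have h1 : Measurable[coordSigma B {q | q.2 ≤ t * p i}] (B (u, t * p (j + 1))) :=
      measurable_coordSigma B (show t * p (j + 1) ≤ t * p i by gcongr; exact hp.mono hj)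
    have h2 : Measurable[coordSigma B {q | q.2 ≤ t * p i}] (B (u, t * p j)) :=
      measurable_coordSigma B (show t * p j ≤ t * p i by gcongr; exact hp.mono hj.le)
    exact ((h1.sub h2).pow_const 2).sub_const _
  have hsum : ∀ ω, quadVar p k (fun r => B (u, r) ω) t - u * t
      = ∑ j ∈ Finset.range k, D j ω := fun ω => by
    simp only [hD]
    rw [Finset.sum_sub_distrib, ← Finset.mul_sum,
      Finset.sum_range_sub (fun j => ((t * p j : ℝ≥0) : ℝ)), hp.zero, hp.one]
    simp [quadVar]
  simp only [hsum]
  have key := integral_sum_pow_four_le (P := P) D s sqConst_nonneg (fun j => sq_nonneg _) hDm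
    (fun i => ?_) (fun i => ?_) (fun i => ?_) k
  · refine key.trans ?_
    have hS : ∑ j ∈ Finset.range k, s j ≤ (u * t) ^ 2 * δ := by
      calc ∑ j ∈ Finset.range k, s j
          ≤ ∑ j ∈ Finset.range k, ((u * t : ℝ) ^ 2 * δ) * ((p (j + 1) : ℝ) - p j) := by
            refine Finset.sum_le_sum fun j hj => ?_
            have h1 := hp.le j (Finset.mem_range.1 hj)
            have h2 : 0 ≤ (p (j + 1) : ℝ) - p j :=
              sub_nonneg.2 (NNReal.coe_le_coe.2 (hp.mono (Nat.le_succ j)))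
            calc s j = (u * t : ℝ) ^ 2 * (((p (j + 1) : ℝ) - p j) * ((p (j + 1) : ℝ) - p j)) := by
                  simp only [hs, NNReal.coe_mul]; ring
              _ ≤ (u * t : ℝ) ^ 2 * (δ * ((p (j + 1) : ℝ) - p j)) := by gcongr
              _ = _ := by ring
        _ = _ := by
            rw [← Finset.mul_sum, Finset.sum_range_sub (fun j => (p j : ℝ)), hp.zero, hp.one]
            simp
    have hS0 : 0 ≤ ∑ j ∈ Finset.range k, s j := Finset.sum_nonneg fun j _ => sq_nonneg _
    have := sqConst_nonneg
    gcongr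
  -- The cube of a centred square need not be centred; the product vanishes because the past sum is
  -- centred and independent of it.
  · have := hB.integral_mul_increment u (hmono i) (hF i)
      (g := fun x => (x ^ 2 - u * (((t * p (i + 1) : ℝ≥0) : ℝ) - ((t * p i : ℝ≥0) : ℝ))) ^ 3)
      (by fun_prop)
    rw [this, integral_finsetSum _ fun j _ => (hDm j).integrable,
      Finset.sum_eq_zero fun j _ => hD0 j, zero_mul]
  · have := hB.integral_mul_increment u (hmono i) ((hF i).pow_const 3)
      (g := fun x => x ^ 2 - u * (((t * p (i + 1) : ℝ≥0) : ℝ) - ((t * p i : ℝ≥0) : ℝ)))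
      (by fun_prop)
    rw [this, hB.integral_centred_sq u (hmono i), mul_zero]
  · refine (hB.integral_centred_sq_pow_four_le u (hmono i)).trans_eq ?_
    simp only [hs]
    ring

/-- Fourth moment of a discrete stochastic integral of increments of the Gaussian process. -/
theorem integral_sum_increment_mul_pow_four_le (hB : IsPreSheet P B) (u : ℝ≥0)
    {c y z : ℕ → ℝ≥0} (hc : Monotone c) (hy : ∀ i, y i ≤ c i) (hz : ∀ i, z i ≤ c i) (N : ℕ) :
    ∫ ω, (∑ i ∈ Finset.range N, 2 * ((B (u, c (i + 1)) ω - B (u, c i) ω) *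
        (B (u, z i) ω - B (u, y i) ω))) ^ 4 ∂P
      ≤ 144 * gaussianMoment 4 ^ 2 *
        (u ^ 2 * ∑ i ∈ Finset.range N, ((c (i + 1) : ℝ) - c i) * |(z i : ℝ) - y i|) ^ 2 := by
  have := hB.isProbabilityMeasure
  set D : ℕ → S → ℝ := fun i ω => 2 * ((B (u, c (i + 1)) ω - B (u, c i) ω) *
        (B (u, z i) ω - B (u, y i) ω)) with hD
  set s : ℕ → ℝ := fun i => u ^ 2 * (((c (i + 1) : ℝ) - c i) * |(z i : ℝ) - y i|) with hs
  have hci : ∀ i, c i ≤ c (i + 1) := fun i => hc (Nat.le_succ i)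
  have hci' : ∀ i, (0 : ℝ) ≤ (c (i + 1) : ℝ) - c i := fun i =>
    sub_nonneg.2 (NNReal.coe_le_coe.2 (hci i))
  have hDm : ∀ i, HasAllMoments (D i) P := fun i =>
    ((hB.hasAllMoments_sub _ _).mul (hB.hasAllMoments_sub _ _)).const_mul 2
  have hL : ∀ i, Measurable[coordSigma B {q | q.2 ≤ c i}]
      (fun ω => B (u, z i) ω - B (u, y i) ω) := fun i =>
    (measurable_coordSigma B (hz i)).sub (measurable_coordSigma B (hy i))
  have hF : ∀ i, Measurable[coordSigma B {q | q.2 ≤ c i}]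
      (fun ω => ∑ j ∈ Finset.range i, D j ω) := fun i => by
    refine Finset.measurable_fun_sum _ fun j hj => ?_
    rw [Finset.mem_range] at hj
    have h1 : Measurable[coordSigma B {q | q.2 ≤ c i}] (B (u, c (j + 1))) :=
      measurable_coordSigma B (hc hj)
    have h2 : Measurable[coordSigma B {q | q.2 ≤ c i}] (B (u, c j)) :=
      measurable_coordSigma B (hc hj.le)
    have h3 := (hL j).mono (coordSigma_mono B (T' := {q | q.2 ≤ c i})
      fun q hq => le_trans hq (hc hj.le)) le_rfl
    exact ((h1.sub h2).mul h3).const_mul 2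
  have hodd : ∀ i n, Odd n → ∫ ω, (B (u, c (i + 1)) ω - B (u, c i) ω) ^ n ∂P = 0 := fun i n hn =>
    (hB.hasLaw_sub u (hci i)).integral_pow_odd_gaussianReal hn
  have key := integral_sum_pow_four_le (P := P) D s (K := 16 * gaussianMoment 4 ^ 2)
    (by positivity) (fun i => mul_nonneg (by positivity) (mul_nonneg (hci' i) (abs_nonneg _))) hDm
    (fun i => ?_) (fun i => ?_) (fun i => ?_) N
  · refine key.trans_eq ?_
    simp only [hs, ← Finset.mul_sum]
    ring
  -- Here the weight `B (u, z i) - B (u, y i)` belongs to the past, so odd powers of the summand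
  -- vanish through the odd moments of the fresh increment.
  · have := hB.integral_mul_increment u (hci i)
      ((hF i).mul (((hL i).pow_const 3).const_mul 8)) (g := fun x => x ^ 3) (by fun_prop)
    rw [hodd i 3 (by decide), mul_zero] at this
    rw [← this]
    congr 1
    ext ω
    simp only [hD, Pi.mul_apply]
    ring
  · have := hB.integral_mul_increment u (hci i)
      (((hF i).pow_const 3).mul ((hL i).const_mul 2)) (g := fun x => x ^ 1) (by fun_prop)
    rw [hodd i 1 (by decide), mul_zero] at this
    rw [← this]
    congr 1
    ext ω
    simp only [hD, Pi.mul_apply]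
    ring
  · have := hB.integral_mul_increment u (hci i)
      (((hL i).pow_const 4).const_mul 16) (g := fun x => x ^ 4) (by fun_prop)
    rw [integral_const_mul, hB.integral_sub_pow_four, hB.integral_sub_pow_four,
      abs_of_nonneg (hci' i)] at this
    refine le_of_eq ?_
    calc ∫ ω, D i ω ^ 4 ∂P = _ := by
          congr 1
          ext ω
          show _ = 16 * (B (u, z i) ω - B (u, y i) ω) ^ 4 *
            (B (u, c (i + 1)) ω - B (u, c i) ω) ^ 4
          simp only [hD]
          ring
      _ = _ := this
      _ = _ := by simp only [hs]; ring

end IsPreSheet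

/-- The constant in the fourth moment bound for differences of sums of squared increments. -/
noncomputable def diffConst : ℝ := 8 * (1296 * gaussianMoment 4 ^ 2 + sqConst)

theorem diffConst_nonneg : 0 ≤ diffConst := by
  have := sqConst_nonneg
  unfold diffConst
  positivity

/-- Fourth moment of the difference between the centred sums of squared increments along two
dilations of the same partition. -/
theorem IsPreSheet.integral_quadVar_sub_quadVar_pow_four_le {S : Type*} [MeasurableSpace S]
    {P : Measure S} {B : ℝ≥0 × ℝ≥0 → S → ℝ} (hB : IsPreSheet P B) (u : ℝ≥0) {t t' : ℝ≥0}
    (htt' : t ≤ t') (ht' : t' ≤ 1) {p : ℕ → ℝ≥0} {k : ℕ} {δ : ℝ} (hp : IsPartitionSeq p k δ) :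
    ∫ ω, ((quadVar p k (fun r => B (u, r) ω) t - u * t)
        - (quadVar p k (fun r => B (u, r) ω) t' - u * t')) ^ 4 ∂P
      ≤ diffConst * u ^ 4 * ((t' : ℝ) - t) ^ 2 := by
  have := hB.isProbabilityMeasure
  obtain ⟨c, y, z, N, hc, hy, hz, hsum, hw⟩ :=
    exists_grid_sum_sq_sub hp.mono hp.zero hp.one htt' ht'
  have hf := hB.integral_sum_increment_mul_pow_four_le u hc hy hz N
  have hg := hB.integral_centred_sq_pow_four_le u htt'
  set f : S → ℝ := fun ω => ∑ i ∈ Finset.range N, 2 * ((B (u, c (i + 1)) ω - B (u, c i) ω) *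
        (B (u, z i) ω - B (u, y i) ω)) with hf_def
  set g : S → ℝ := fun ω => (B (u, t') ω - B (u, t) ω) ^ 2 - u * ((t' : ℝ) - t) with hg_def
  have hfm : HasAllMoments f P := HasAllMoments.sum _ fun i _ =>
    ((hB.hasAllMoments_sub _ _).mul (hB.hasAllMoments_sub _ _)).const_mul 2
  have hgm : HasAllMoments g P := hB.hasAllMoments_centred_sq _ _ _
  have e : ∀ ω, (quadVar p k (fun r => B (u, r) ω) t - u * t)
        - (quadVar p k (fun r => B (u, r) ω) t' - u * t') = f ω - g ω := fun ω => by
    have := hw fun r => B (u, r) ω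
    simp only [hf_def, hg_def, ← this, quadVar]
    ring
  simp only [e]
  have htr : (0 : ℝ) ≤ (t' : ℝ) - t := sub_nonneg.2 htt'
  have htr1 : (t' : ℝ) - t ≤ 1 := by
    have : (t' : ℝ) ≤ 1 := ht'
    have : (0 : ℝ) ≤ t := t.2
    linarith
  have hsum0 : 0 ≤ ∑ i ∈ Finset.range N, ((c (i + 1) : ℝ) - c i) * |(z i : ℝ) - y i| :=
    Finset.sum_nonneg fun i _ => mul_nonneg
      (sub_nonneg.2 (NNReal.coe_le_coe.2 (hc (Nat.le_succ i)))) (abs_nonneg _)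
  have hK := sqConst_nonneg
  calc ∫ ω, (f ω - g ω) ^ 4 ∂P ≤ ∫ ω, 8 * (f ω ^ 4 + g ω ^ 4) ∂P := by
        refine integral_mono ((hfm.sub hgm).pow 4).integrable
          (((hfm.pow 4).add (hgm.pow 4)).const_mul 8).integrable fun ω => ?_
        exact sub_pow_four_le _ _
    _ = 8 * (∫ ω, f ω ^ 4 ∂P + ∫ ω, g ω ^ 4 ∂P) := by
        rw [integral_const_mul, integral_add (hfm.pow 4).integrable (hgm.pow 4).integrable]
    _ ≤ 8 * (144 * gaussianMoment 4 ^ 2 * (u ^ 2 * (3 * ((t' : ℝ) - t))) ^ 2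
          + sqConst * (u * ((t' : ℝ) - t)) ^ 4) := by
        gcongr
        exact hf.trans (by gcongr)
    -- As `t' - t ≤ 1`, the fourth power coming from the single square is absorbed into the second
    -- power.
    _ ≤ 8 * (144 * gaussianMoment 4 ^ 2 * (u ^ 2 * (3 * ((t' : ℝ) - t))) ^ 2
          + sqConst * (u ^ 4 * ((t' : ℝ) - t) ^ 2)) := by
        rw [mul_pow (u : ℝ) _ 4]
        gcongr ?_ * (_ + ?_ * (_ * ?_))
        exact pow_le_pow_of_le_one htr htr1 (by norm_num)
    _ = _ := by unfold diffConst; ring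

/-! ### The martingale structure in the first parameter and maximal inequalities. -/

/-- A linear combination of centred squared increments of `B` at level `u`. -/
noncomputable def centredSquares {S ι : Type*} (B : ℝ≥0 × ℝ≥0 → S → ℝ) (E : Finset ι)
    (a : ι → ℝ) (x y : ι → ℝ≥0) (u : ℝ≥0) (ω : S) : ℝ :=
  ∑ e ∈ E, a e * ((B (u, y e) ω - B (u, x e) ω) ^ 2 - u * ((y e : ℝ) - x e))

theorem measurable_centredSquares {S : Type*} (B : ℝ≥0 × ℝ≥0 → S → ℝ) {ι : Type*} (E : Finset ι)
    (a : ι → ℝ) (x y : ι → ℝ≥0) (u : ℝ≥0) :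
    Measurable[coordSigma B {q | q.1 ≤ u}] (centredSquares B E a x y u) := by
  refine Finset.measurable_fun_sum _ fun e _ => ?_
  have h1 : Measurable[coordSigma B {q | q.1 ≤ u}] (B (u, y e)) :=
    measurable_coordSigma B (le_refl u)
  have h2 : Measurable[coordSigma B {q | q.1 ≤ u}] (B (u, x e)) :=
    measurable_coordSigma B (le_refl u)
  exact (((h1.sub h2).pow_const 2).sub_const _).const_mul _

namespace IsPreSheet

variable {S : Type*} [MeasurableSpace S] {P : Measure S} {B : ℝ≥0 × ℝ≥0 → S → ℝ}

theorem hasAllMoments_centredSquares (hB : IsPreSheet P B) {ι : Type*} (E : Finset ι)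
    (a : ι → ℝ) (x y : ι → ℝ≥0) (u : ℝ≥0) : HasAllMoments (centredSquares B E a x y u) P :=
  HasAllMoments.sum _ fun _ _ => (hB.hasAllMoments_centred_sq _ _ _).const_mul _

/-- This is the martingale property tested against `F`. If `D` is an increment at level `u` and `D +
d` the same increment at level `v`, the centred square changes by `2 D d + (d² - (v - u)(y - x))`.
Here `d` is independent of the past up to `u`, and both `d` and the last bracket have mean zero. -/
theorem integral_mul_centredSquares_sub (hB : IsPreSheet P B) {ι : Type*} (E : Finset ι)
    (a : ι → ℝ) {x y : ι → ℝ≥0} (hxy : ∀ e ∈ E, x e ≤ y e) {u v : ℝ≥0} (huv : u ≤ v)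
    {F : S → ℝ} (hF : Measurable[coordSigma B {q | q.1 ≤ u}] F) (hFm : HasAllMoments F P) :
    ∫ ω, F ω * (centredSquares B E a x y v ω - centredSquares B E a x y u ω) ∂P = 0 := by
  have := hB.isProbabilityMeasure
  set d : ι → S → ℝ := fun e ω => (B (v, y e) ω - B (u, y e) ω) - (B (v, x e) ω - B (u, x e) ω)
    with hd
  set D : ι → S → ℝ := fun e ω => B (u, y e) ω - B (u, x e) ω with hD
  have hdm : ∀ e, HasAllMoments (d e) P := fun e =>
    (hB.hasAllMoments_sub _ _).sub (hB.hasAllMoments_sub _ _)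
  have hDm : ∀ e, HasAllMoments (D e) P := fun e => hB.hasAllMoments_sub _ _
  have hDF : ∀ e, Measurable[coordSigma B {q | q.1 ≤ u}] (D e) := fun e =>
    (measurable_coordSigma B (le_refl u)).sub (measurable_coordSigma B (le_refl u))
  have hd0 : ∀ e, ∫ ω, d e ω ∂P = 0 := fun e => by
    rw [integral_sub (hB.hasAllMoments_sub _ _).integrable (hB.hasAllMoments_sub _ _).integrable,
      integral_sub (hB.hasAllMoments _).integrable (hB.hasAllMoments _).integrable,
      integral_sub (hB.hasAllMoments _).integrable (hB.hasAllMoments _).integrable]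
    simp [hB.centered]
  have hdD : ∀ e (G : S → ℝ), Measurable[coordSigma B {q | q.1 ≤ u}] G →
      ∫ ω, G ω * d e ω ∂P = 0 := fun e G hG => by
    have := hB.integral_mul_increments huv hG (g := fun f => f (y e) - f (x e))
      ((measurable_pi_apply _).sub (measurable_pi_apply _))
    exact this.trans (mul_eq_zero_of_right _ (hd0 e))
  -- The variance of `d` comes from those at levels `v` and `u`, since `d² = (D + d)² - D² - 2 D d`
  -- and the product has mean zero.
  have hd2 : ∀ e ∈ E, ∫ ω, (d e ω ^ 2 - ((v : ℝ) - u) * ((y e : ℝ) - x e)) ∂P = 0 := by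
    intro e he
    have h1 := hB.integral_centred_sq v (hxy e he)
    have h2 := hB.integral_centred_sq u (hxy e he)
    have h3 := hdD e (fun ω => 2 * D e ω) ((hDF e).const_mul 2)
    have i1 := (hB.hasAllMoments_centred_sq (v, y e) (v, x e) (v * ((y e : ℝ) - x e))).integrable
    have i2 := (hB.hasAllMoments_centred_sq (u, y e) (u, x e) (u * ((y e : ℝ) - x e))).integrable
    have i3 := (((hDm e).const_mul 2).mul (hdm e)).integrable
    have h4 := integral_sub (i1.sub i2) i3
    rw [h3, integral_sub' i1 i2, h1, h2] at h4
    rw [show (0 : ℝ) = 0 - 0 - 0 by norm_num, ← h4]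
    congr 1
    ext ω
    simp only [hd, hD, Pi.sub_apply]
    ring
  have e1 : ∀ ω, F ω * (centredSquares B E a x y v ω - centredSquares B E a x y u ω)
      = ∑ e ∈ E, a e * (F ω * (2 * D e ω) * d e ω
        + F ω * (d e ω ^ 2 - ((v : ℝ) - u) * ((y e : ℝ) - x e))) := fun ω => by
    simp only [centredSquares]
    rw [← Finset.sum_sub_distrib, Finset.mul_sum]
    refine Finset.sum_congr rfl fun e _ => ?_
    simp only [hd, hD]
    ring
  simp only [e1]
  have j1 : ∀ e, Integrable (fun ω => F ω * (2 * D e ω) * d e ω) P := fun e =>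
    ((hFm.mul ((hDm e).const_mul 2)).mul (hdm e)).integrable
  have j2 : ∀ e, Integrable (fun ω => F ω * (d e ω ^ 2 - ((v : ℝ) - u) * ((y e : ℝ) - x e))) P :=
    fun e => (hFm.mul (((hdm e).pow 2).sub (.const _))).integrable
  have j3 : ∀ e ∈ E, Integrable (fun ω => a e * (F ω * (2 * D e ω) * d e ω
      + F ω * (d e ω ^ 2 - ((v : ℝ) - u) * ((y e : ℝ) - x e)))) P :=
    fun e _ => ((j1 e).add (j2 e)).const_mul _
  rw [integral_finsetSum _ j3]
  refine Finset.sum_eq_zero fun e he => ?_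
  rw [integral_const_mul, integral_add (j1 e) (j2 e),
    show ∫ ω, F ω * (2 * D e ω) * d e ω ∂P = 0 from hdD e _ (hF.mul ((hDF e).const_mul 2))]
  have := hB.integral_mul_increments huv hF
    (g := fun f => (f (y e) - f (x e)) ^ 2 - ((v : ℝ) - u) * ((y e : ℝ) - x e))
    (by fun_prop)
  rw [show ∫ ω, F ω * (d e ω ^ 2 - ((v : ℝ) - u) * ((y e : ℝ) - x e)) ∂P = 0 from
    this.trans (mul_eq_zero_of_right _ (hd2 e he))]
  simp

/-- Conditional Jensen by hand: `t ^ 4` lies above its tangent line at the present value, and the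
linear term integrates to zero over past events by the martingale property. -/
theorem submartingale_centredSquares_pow_four (hB : IsPreSheet P B) {ι : Type*} (E : Finset ι)
    (a : ι → ℝ) {x y : ι → ℝ≥0} (hxy : ∀ e ∈ E, x e ≤ y e) {U : ℕ → ℝ≥0} (hU : Monotone U) :
    Submartingale (fun i ω => centredSquares B E a x y (U i) ω ^ 4)
      (⟨fun i => coordSigma B {q | q.1 ≤ U i},
        fun _ _ hij => coordSigma_mono B fun _ hq => le_trans hq (hU hij),
        fun _ => coordSigma_le hB.measurable _⟩ : Filtration ℕ ‹MeasurableSpace S›) P := by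
  have := hB.isProbabilityMeasure
  have hY := hB.hasAllMoments_centredSquares E a x y
  refine submartingale_of_setIntegral_le_succ
    (fun i => ((measurable_centredSquares B E a x y (U i)).pow_const 4).stronglyMeasurable)
    (fun i => ((hY _).pow 4).integrable) fun i A hA => ?_
  have hA' : MeasurableSet A := coordSigma_le hB.measurable _ A hA
  set Y := centredSquares B E a x y (U i) with hYdef
  set Y' := centredSquares B E a x y (U (i + 1)) with hYdef'
  have hG : Measurable[coordSigma B {q | q.1 ≤ U i}] (A.indicator fun ω => 4 * Y ω ^ 3) :=
    (((measurable_centredSquares B E a x y (U i)).pow_const 3).const_mul 4).indicator hA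
  have hGm : HasAllMoments (A.indicator fun ω => 4 * Y ω ^ 3) P :=
    (((hY _).pow 3).const_mul 4).indicator hA'
  have h0 := hB.integral_mul_centredSquares_sub E a hxy (hU (Nat.le_succ i)) hG hGm
  have h1 : ∫ ω in A, 4 * Y ω ^ 3 * (Y' ω - Y ω) ∂P = 0 := by
    rw [← h0, ← integral_indicator hA']
    congr 1
    ext ω
    by_cases h : ω ∈ A <;> simp [h, hYdef, hYdef']
  have i1 : Integrable (fun ω => Y ω ^ 4) P := ((hY _).pow 4).integrable
  have i2 : Integrable (fun ω => 4 * Y ω ^ 3 * (Y' ω - Y ω)) P :=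
    ((((hY _).pow 3).const_mul 4).mul ((hY _).sub (hY _))).integrable
  calc ∫ ω in A, Y ω ^ 4 ∂P = ∫ ω in A, (Y ω ^ 4 + 4 * Y ω ^ 3 * (Y' ω - Y ω)) ∂P := by
        rw [integral_add i1.integrableOn i2.integrableOn, h1, add_zero]
    _ ≤ ∫ ω in A, Y' ω ^ 4 ∂P := by
        refine integral_mono (i1.add i2).integrableOn ((hY _).pow 4).integrable.integrableOn
          fun ω => ?_
        have h2 : ∀ s t : ℝ, s ^ 4 + 4 * s ^ 3 * (t - s) ≤ t ^ 4 := fun s t => by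
          nlinarith [mul_nonneg (sq_nonneg (s - t)) (sq_nonneg (s + t)),
            mul_nonneg (sq_nonneg (s - t)) (sq_nonneg s), mul_nonneg (sq_nonneg (s - t))
            (sq_nonneg (t + s)), mul_nonneg (sq_nonneg (s - t)) (add_nonneg (sq_nonneg (s + t))
            (mul_nonneg zero_le_two (sq_nonneg s)))]
        exact h2 _ _

/-- Maximal inequality for linear combinations of centred squared increments. -/
theorem measure_exists_le_abs_centredSquares_le (hB : IsPreSheet P B) {ι : Type*} (E : Finset ι)
    (a : ι → ℝ) {x y : ι → ℝ≥0} (hxy : ∀ e ∈ E, x e ≤ y e) {U : ℕ → ℝ≥0} (hU : Monotone U)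
    (n : ℕ) {C : ℝ} (hC : ∫ ω, centredSquares B E a x y (U n) ω ^ 4 ∂P ≤ C) {ε : ℝ} (hε : 0 < ε) :
    P {ω | ∃ i ≤ n, (ε : ℝ) ≤ |centredSquares B E a x y (U i) ω|} ≤ ENNReal.ofReal (C / ε ^ 4) := by
  have := hB.isProbabilityMeasure
  lift ε to ℝ≥0 using hε.le
  have hε' : ε ≠ 0 := by
    rintro rfl
    simp at hε
  have h := maximal_ineq (hB.submartingale_centredSquares_pow_four E a hxy hU)
    (fun i ω => (show Even 4 by decide).pow_nonneg _) (ε := ε ^ 4) n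
  have h2 : ((ε ^ 4 : ℝ≥0) : ℝ≥0∞) * P {ω | ∃ i ≤ n, (ε : ℝ) ≤ |centredSquares B E a x y (U i) ω|}
      ≤ ENNReal.ofReal C := by
    have hsub : {ω | ∃ i ≤ n, (ε : ℝ) ≤ |centredSquares B E a x y (U i) ω|} ⊆
        {ω | ((ε ^ 4 : ℝ≥0) : ℝ) ≤ (Finset.range (n + 1)).sup' Finset.nonempty_range_add_one
          fun i => centredSquares B E a x y (U i) ω ^ 4} := by
      rintro ω ⟨i, hi, hi'⟩
      have h3 : (ε : ℝ) ^ 4 ≤ centredSquares B E a x y (U i) ω ^ 4 := by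
        rw [← (show Even 4 by decide).pow_abs (centredSquares B E a x y (U i) ω)]
        exact pow_le_pow_left₀ ε.2 hi' 4
      rw [Set.mem_ofPred_eq, NNReal.coe_pow]
      exact h3.trans (Finset.le_sup' (fun j => centredSquares B E a x y (U j) ω ^ 4)
        (Finset.mem_range.2 (Nat.lt_succ_of_le hi)))
    refine (mul_le_mul_right (measure_mono hsub) _).trans (h.trans ?_)
    refine ENNReal.ofReal_le_ofReal (le_trans ?_ hC)
    exact setIntegral_le_integral ((hB.hasAllMoments_centredSquares E a x y _).pow 4).integrable
      (Filter.Eventually.of_forall fun ω => (show Even 4 by decide).pow_nonneg _)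
  rw [ENNReal.ofReal_div_of_pos (by positivity), ENNReal.le_div_iff_mul_le, mul_comm]
  · convert h2 using 2
    rw [← NNReal.coe_pow, ENNReal.ofReal_coe_nnreal]
  · left; simp; positivity
  · left; simp

end IsPreSheet

/-! ### From discrete levels to all levels of the continuous sheet. -/

/-- A Brownian sheet has a modification whose coordinates are measurable. -/
theorem IsBrownianSheet.exists_isPreSheet {S : Type*} [MeasurableSpace S] {P : Measure S}
    {W : S → C(ℝ≥0 × ℝ≥0, ℝ)} (hW : IsBrownianSheet P W) :
    ∃ B : ℝ≥0 × ℝ≥0 → S → ℝ, IsPreSheet P B ∧ ∀ p, (fun ω => W ω p) =ᵐ[P] B p := by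
  have hm := hW.gaussian.aemeasurable
  have hae : ∀ p, (fun ω => W ω p) =ᵐ[P] (hm p).mk := fun p => (hm p).ae_eq_mk
  refine ⟨fun p => (hm p).mk, ⟨hW.gaussian.congr hae, fun p => (hm p).measurable_mk,
    fun p => ?_, fun p q => ?_⟩, hae⟩
  · rw [← integral_congr_ae (hae p), hW.centered]
  · rw [← hW.covariance p q]
    unfold ProbabilityTheory.covariance
    rw [integral_congr_ae (hae p),
      integral_congr_ae (hae q)]
    refine integral_congr_ae ?_
    filter_upwards [hae p, hae q] with ω h1 h2
    simp only [h1, h2]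

theorem continuous_centredSquares {S ι : Type*} (W : S → C(ℝ≥0 × ℝ≥0, ℝ)) (E : Finset ι)
    (a : ι → ℝ) (x y : ι → ℝ≥0) (ω : S) :
    Continuous fun u => centredSquares (fun p ω => W ω p) E a x y u ω := by
  unfold centredSquares
  fun_prop

theorem tendsto_floor_mul_two_pow_div (x : ℝ≥0) :
    Filter.Tendsto (fun n : ℕ => (⌊x * 2 ^ n⌋₊ : ℝ≥0) / 2 ^ n) Filter.atTop (nhds x) := by
  have h1 : Filter.Tendsto (fun n : ℕ => (2 : ℝ) ^ n) Filter.atTop Filter.atTop :=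
    tendsto_pow_atTop_atTop_of_one_lt (by norm_num)
  rw [← NNReal.tendsto_coe]
  convert (tendsto_nat_floor_mul_div_atTop x.coe_nonneg).comp h1 using 2 with n
  have h2 : ⌊x * 2 ^ n⌋₊ = ⌊(x : ℝ) * 2 ^ n⌋₊ := by
    rw [eq_comm, Nat.floor_eq_iff (by positivity)]
    exact ⟨by exact_mod_cast Nat.floor_le (zero_le (a := x * 2 ^ n)),
      by exact_mod_cast Nat.lt_floor_add_one (x * 2 ^ n)⟩
  simp [h2]

/-- Maximal inequality over a continuous range of the first parameter. -/
theorem IsBrownianSheet.measure_exists_lt_abs_centredSquares_le {S : Type*} [MeasurableSpace S]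
    {P : Measure S} {W : S → C(ℝ≥0 × ℝ≥0, ℝ)} (hW : IsBrownianSheet P W) {ι : Type*}
    (E : Finset ι) (a : ι → ℝ) {x y : ι → ℝ≥0} (hxy : ∀ e ∈ E, x e ≤ y e) (U : ℝ≥0) {C : ℝ}
    (hC : ∀ B : ℝ≥0 × ℝ≥0 → S → ℝ, IsPreSheet P B →
      ∫ ω, centredSquares B E a x y U ω ^ 4 ∂P ≤ C) {ε : ℝ} (hε : 0 < ε) :
    P {ω | ∃ u ≤ U, ε < |centredSquares (fun p ω => W ω p) E a x y u ω|}
      ≤ ENNReal.ofReal (C / ε ^ 4) := by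
  obtain ⟨B, hB, hae⟩ := hW.exists_isPreSheet
  set g : ℕ → ℕ → ℝ≥0 := fun n i => U * (i / 2 ^ n) with hg
  set A : ℕ → Set S := fun n =>
    {ω | ∃ i ≤ 2 ^ n, ε ≤ |centredSquares (fun p ω => W ω p) E a x y (g n i) ω|} with hA
  have hgn : ∀ n, g n (2 ^ n) = U := fun n => by simp [hg]
  have hbound : ∀ n, P (A n) ≤ ENNReal.ofReal (C / ε ^ 4) := by
    intro n
    have hmono : Monotone (g n) := fun i j hij => by
      simp only [hg]
      gcongr
    have h := hB.measure_exists_le_abs_centredSquares_le E a hxy hmono (2 ^ n)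
      (C := C) (by rw [hgn]; exact hC B hB) hε
    refine le_trans (measure_mono_ae ?_) h
    -- Only countably many coordinates enter at dyadic level `n`, so the modification agrees with
    -- the sheet on all of them outside one null set.
    have h1 : ∀ᵐ ω ∂P, ∀ i : ℕ, ∀ e ∈ E, W ω (g n i, x e) = B (g n i, x e) ω ∧
        W ω (g n i, y e) = B (g n i, y e) ω := by
      refine ae_all_iff.2 fun i => (Filter.eventually_all_finset E).2 fun e _ => ?_
      filter_upwards [hae (g n i, x e), hae (g n i, y e)] with ω h1 h2 using ⟨h1, h2⟩
    filter_upwards [h1] with ω hω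
    rintro ⟨i, hi, hi'⟩
    refine ⟨i, hi, ?_⟩
    convert hi' using 2
    refine Finset.sum_congr rfl fun e he => ?_
    simp only [(hω i e he).1, (hω i e he).2]
  have hAmono : Monotone A := by
    refine monotone_nat_of_le_succ fun n => ?_
    rintro ω ⟨i, hi, hi'⟩
    refine ⟨2 * i, by rw [pow_succ]; omega, ?_⟩
    have : g (n + 1) (2 * i) = g n i := by
      simp only [hg, pow_succ]
      push_cast
      congr 1
      field_simp
    rwa [this]
  -- The dyadic grids are nested, so the events increase and the uniform bound passes to their union
  -- with no loss and no measurability requirement.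
  refine le_trans (measure_mono ?_) ((hAmono.measure_iUnion (μ := P)).trans_le (iSup_le hbound))
  rintro ω ⟨u, hu, hu'⟩
  have hlim : Filter.Tendsto (fun n : ℕ => g n ⌊(u / U) * (2 : ℝ≥0) ^ n⌋₊) Filter.atTop
      (nhds u) := by
    have h2 := (tendsto_floor_mul_two_pow_div (u / U)).const_mul U
    have h3 : U * (u / U) = u := by
      rcases eq_or_ne U 0 with rfl | hU
      · simp [le_antisymm hu zero_le]
      · field_simp
    rw [h3] at h2
    exact h2
  -- By continuity in `u`, the strict inequality at `u` persists at a nearby dyadic level; hence `<`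
  -- in the conclusion against `≤` in `A`.
  have hev := ((continuous_centredSquares W E a x y ω).abs.tendsto u).comp hlim
  obtain ⟨n, hn⟩ := (hev.eventually (lt_mem_nhds hu')).exists
  refine Set.mem_iUnion.2 ⟨n, _, ?_, hn.le⟩
  refine Nat.floor_le_of_le ?_
  push_cast
  exact mul_le_of_le_one_left zero_le (div_le_one_of_le₀ hu zero_le)

section

variable {S : Type*} [MeasurableSpace S] {P : Measure S} {W : S → C(ℝ≥0 × ℝ≥0, ℝ)}

/-- The deviation of the sum of squared increments of `w (u, ·)` from its mean. -/
noncomputable def deviation (p : ℕ → ℝ≥0) (k : ℕ) (w : C(ℝ≥0 × ℝ≥0, ℝ)) (u t : ℝ≥0) : ℝ :=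
  quadVar p k (fun r => w (u, r)) t - u * t

theorem quadVar_sub_eq_sum {p : ℕ → ℝ≥0} {k : ℕ} {δ : ℝ} (hp : IsPartitionSeq p k δ)
    (w : ℝ≥0 → ℝ) (u t : ℝ≥0) :
    quadVar p k w t - u * t = ∑ j ∈ Finset.range k, ((w (t * p (j + 1)) - w (t * p j)) ^ 2
      - u * (((t * p (j + 1) : ℝ≥0) : ℝ) - ((t * p j : ℝ≥0) : ℝ))) := by
  rw [Finset.sum_sub_distrib, ← Finset.mul_sum,
    Finset.sum_range_sub (fun j => ((t * p j : ℝ≥0) : ℝ)), hp.zero, hp.one]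
  simp [quadVar]

theorem IsBrownianSheet.measure_exists_lt_abs_deviation_le (hW : IsBrownianSheet P W)
    {p : ℕ → ℝ≥0} {k : ℕ} {δ : ℝ} (hp : IsPartitionSeq p k δ) (U t : ℝ≥0) {ε : ℝ}
    (hε : 0 < ε) :
    P {ω | ∃ u ≤ U, ε < |deviation p k (W ω) u t|}
      ≤ ENNReal.ofReal (9 * sqConst * ((U * t) ^ 2 * δ) ^ 2 / ε ^ 4) := by
  have e : ∀ (B : ℝ≥0 × ℝ≥0 → S → ℝ) u ω, quadVar p k (fun r => B (u, r) ω) t - u * t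
      = centredSquares B (Finset.range k) (fun _ => 1) (fun j => t * p j)
        (fun j => t * p (j + 1)) u ω := fun B u ω => by
    rw [quadVar_sub_eq_sum hp]
    simp only [centredSquares, one_mul]
  have h := hW.measure_exists_lt_abs_centredSquares_le (Finset.range k) (fun _ => 1)
    (x := fun j => t * p j) (y := fun j => t * p (j + 1))
    (fun j _ => by gcongr; exact hp.mono (Nat.le_succ j)) U
    (fun B hB => by
      simp only [← e]
      exact hB.integral_quadVar_sub_pow_four_le U t hp) hε
  simpa only [← e, deviation] using h

/-- With weights `1` and `-1` on a disjoint union of index sets, the difference is itself a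
combination of centred squares, so the same maximal inequality covers it. -/
theorem IsBrownianSheet.measure_exists_lt_abs_deviation_sub_le (hW : IsBrownianSheet P W)
    {p : ℕ → ℝ≥0} {k : ℕ} {δ : ℝ} (hp : IsPartitionSeq p k δ) (U : ℝ≥0) {t t' : ℝ≥0}
    (htt' : t ≤ t') (ht' : t' ≤ 1) {ε : ℝ} (hε : 0 < ε) :
    P {ω | ∃ u ≤ U, ε < |deviation p k (W ω) u t - deviation p k (W ω) u t'|}
      ≤ ENNReal.ofReal (diffConst * U ^ 4 * ((t' : ℝ) - t) ^ 2 / ε ^ 4) := by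
  have e : ∀ (B : ℝ≥0 × ℝ≥0 → S → ℝ) u ω, (quadVar p k (fun r => B (u, r) ω) t - u * t)
      - (quadVar p k (fun r => B (u, r) ω) t' - u * t')
      = centredSquares B ((Finset.range k).disjSum (Finset.range k)) (Sum.elim 1 (-1))
        (Sum.elim (fun j => t * p j) (fun j => t' * p j))
        (Sum.elim (fun j => t * p (j + 1)) (fun j => t' * p (j + 1))) u ω := fun B u ω => by
    rw [quadVar_sub_eq_sum hp, quadVar_sub_eq_sum hp]
    simp only [centredSquares, Finset.sum_disjSum, Sum.elim_inl, Sum.elim_inr, Pi.one_apply,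
      Pi.neg_apply, neg_mul, one_mul, Finset.sum_neg_distrib, sub_eq_add_neg]
  have h := hW.measure_exists_lt_abs_centredSquares_le
    ((Finset.range k).disjSum (Finset.range k)) (Sum.elim 1 (-1))
    (x := Sum.elim (fun j => t * p j) (fun j => t' * p j))
    (y := Sum.elim (fun j => t * p (j + 1)) (fun j => t' * p (j + 1)))
    (fun j _ => by
      rcases j with j | j <;>
      · simp only [Sum.elim_inl, Sum.elim_inr]
        gcongr
        exact hp.mono (Nat.le_succ j)) U
    (fun B hB => by
      simp only [← e]
      exact hB.integral_quadVar_sub_quadVar_pow_four_le U htt' ht' hp) hε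
  simpa only [← e, deviation] using h

end

/-! ### Chaining in the second parameter and almost sure uniform convergence. -/

/-- A chaining bound: a continuous function that is small on a dyadic grid and whose increments
along the finer dyadic grids decay geometrically is small on `[0, 1]`. -/
theorem abs_le_of_dyadic_increments {f : ℝ≥0 → ℝ} (hf : Continuous f) {l : ℕ} {η : ℝ}
    (hη : 0 ≤ η) (h0 : ∀ i : ℕ, i ≤ 2 ^ l → |f (i / 2 ^ l)| ≤ η)
    (h1 : ∀ m, ∀ i : ℕ, i < 2 ^ (l + m + 1) →
      |f (i / 2 ^ (l + m + 1)) - f ((i + 1) / 2 ^ (l + m + 1))| ≤ η * (9 / 10) ^ m)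
    {t : ℝ≥0} (ht : t ≤ 1) : |f t| ≤ 11 * η := by
  set T : ℕ → ℝ≥0 := fun n => (⌊t * 2 ^ n⌋₊ : ℝ≥0) / 2 ^ n with hT
  have hfl : ∀ n, ⌊t * 2 ^ n⌋₊ ≤ 2 ^ n := fun n => by
    refine Nat.floor_le_of_le ?_
    push_cast
    exact mul_le_of_le_one_left zero_le ht
  have hstep : ∀ m, |f (T (l + m)) - f (T (l + m + 1))| ≤ η * (9 / 10) ^ m := fun m => by
    -- Consecutive dyadic floors of `t` coincide or are neighbours on the finer grid, according to
    -- the parity of the finer floor.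
    have hdiv : ⌊t * 2 ^ (l + m)⌋₊ = ⌊t * 2 ^ (l + m + 1)⌋₊ / 2 := by
      have := Nat.floor_div_natCast (t * 2 ^ (l + m + 1)) 2
      rw [← this]
      congr 1
      push_cast
      rw [pow_succ]
      field_simp
    have hTm : T (l + m) = ((2 * ⌊t * 2 ^ (l + m)⌋₊ : ℕ) : ℝ≥0) / 2 ^ (l + m + 1) := by
      simp only [hT, pow_succ]
      push_cast
      field_simp
    have hb := hfl (l + m + 1)
    rcases Nat.mod_two_eq_zero_or_one ⌊t * 2 ^ (l + m + 1)⌋₊ with h | h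
    · have h2 : 2 * ⌊t * 2 ^ (l + m)⌋₊ = ⌊t * 2 ^ (l + m + 1)⌋₊ := by omega
      rw [hTm, h2]
      simp only [hT, sub_self, abs_zero]
      positivity
    · have h2 : ⌊t * 2 ^ (l + m + 1)⌋₊ = 2 * ⌊t * 2 ^ (l + m)⌋₊ + 1 := by omega
      have h3 : T (l + m + 1)
          = (((2 * ⌊t * 2 ^ (l + m)⌋₊ : ℕ) : ℝ≥0) + 1) / 2 ^ (l + m + 1) := by
        simp only [hT, h2]
        push_cast
        rfl
      rw [hTm, h3]
      exact h1 m _ (by omega)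
  have hsum : ∀ m, |f (T (l + m))| ≤ η + η * ∑ j ∈ Finset.range m, (9 / 10 : ℝ) ^ j := fun m => by
    induction m with
    | zero => simpa using h0 _ (hfl l)
    | succ m ih =>
      have h2 := abs_sub_abs_le_abs_sub (f (T (l + m + 1))) (f (T (l + m)))
      rw [abs_sub_comm] at h2
      rw [Finset.sum_range_succ, mul_add, ← add_assoc l]
      linarith [hstep m]
  have hgeom : ∀ m, ∑ j ∈ Finset.range m, (9 / 10 : ℝ) ^ j ≤ 10 := fun m => by
    have h2 : (0 : ℝ) ≤ (9 / 10) ^ m := by positivity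
    rw [geom_sum_eq (by norm_num), div_le_iff_of_neg (by norm_num)]
    linarith
  have hlim : Filter.Tendsto (fun m => |f (T (l + m))|) Filter.atTop (nhds |f t|) := by
    have h2 := (hf.abs.tendsto t).comp (tendsto_floor_mul_two_pow_div t)
    have h3 : Filter.Tendsto (fun m => l + m) Filter.atTop Filter.atTop :=
      Filter.tendsto_atTop_mono (fun m => Nat.le_add_left m l) Filter.tendsto_id
    exact h2.comp h3
  refine le_of_tendsto hlim (Filter.Eventually.of_forall fun m => (hsum m).trans ?_)
  have := mul_le_mul_of_nonneg_left (hgeom m) hη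
  linarith

theorem continuous_deviation (p : ℕ → ℝ≥0) (k : ℕ) (w : C(ℝ≥0 × ℝ≥0, ℝ)) (u : ℝ≥0) :
    Continuous (deviation p k w u) := by
  unfold deviation quadVar
  fun_prop

/-- The constant in the tail bound for the uniform deviation. -/
noncomputable def tailConst : ℝ := 18 * sqConst + 5 * diffConst

/-- Tail bound for the deviation of the sums of squared increments, uniformly in both
parameters. -/
theorem IsBrownianSheet.measure_exists_deviation_gt_le {S : Type*} [MeasurableSpace S]
    {P : Measure S} {W : S → C(ℝ≥0 × ℝ≥0, ℝ)} (hW : IsBrownianSheet P W)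
    {p : ℕ → ℝ≥0} {k : ℕ} {δ : ℝ} (hp : IsPartitionSeq p k δ) (hδ0 : 0 < δ) (hδ1 : δ ≤ 1)
    (U : ℝ≥0) {η : ℝ} (hη : 0 < η) :
    P {ω | ∃ u ≤ U, ∃ t ≤ 1, 11 * η < |deviation p k (W ω) u t|}
      ≤ ENNReal.ofReal (tailConst * U ^ 4 / η ^ 4 * δ) := by
  -- The starting scale satisfies `2 ^ l ≤ 1 / δ < 2 ^ (l + 1)`: few enough points for the first
  -- union bound, and a spacing small enough for the increments.
  obtain ⟨l, hl1, hl2⟩ := exists_nat_pow_near (one_le_one_div hδ0 hδ1) (one_lt_two (α := ℝ))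
  have hK := sqConst_nonneg
  have hD := diffConst_nonneg
  set A : ℕ → Set S := fun i => {ω | ∃ u ≤ U, η < |deviation p k (W ω) u (i / 2 ^ l)|} with hA
  set G : ℕ → ℕ → Set S := fun m i => {ω | ∃ u ≤ U, η * (9 / 10) ^ m <
    |deviation p k (W ω) u (i / 2 ^ (l + m + 1))
      - deviation p k (W ω) u ((i + 1) / 2 ^ (l + m + 1))|} with hG
  have hsub : {ω | ∃ u ≤ U, ∃ t ≤ 1, 11 * η < |deviation p k (W ω) u t|} ⊆
      (⋃ i ∈ Finset.range (2 ^ l + 1), A i) ∪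
        ⋃ m, ⋃ i ∈ Finset.range (2 ^ (l + m + 1)), G m i := by
    rintro ω ⟨u, hu, t, ht, h⟩
    by_contra hcon
    simp only [Set.mem_union, Set.mem_iUnion, not_or, not_exists, Finset.mem_range] at hcon
    obtain ⟨hc1, hc2⟩ := hcon
    refine absurd h (not_lt.2 ?_)
    refine abs_le_of_dyadic_increments (continuous_deviation p k (W ω) u) hη.le (l := l)
      (fun i hi => ?_) (fun m i hi => ?_) ht
    · by_contra! h3
      exact hc1 i (by omega) ⟨u, hu, h3⟩
    · by_contra! h3
      exact hc2 m i hi ⟨u, hu, h3⟩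
  have hAle : ∀ i ∈ Finset.range (2 ^ l + 1),
      P (A i) ≤ ENNReal.ofReal (9 * sqConst * U ^ 4 * δ ^ 2 / η ^ 4) := fun i hi => by
    refine (hW.measure_exists_lt_abs_deviation_le hp U (i / 2 ^ l) hη).trans
      (ENNReal.ofReal_le_ofReal ?_)
    have hi1 : (((i : ℝ≥0) / 2 ^ l : ℝ≥0) : ℝ) ≤ 1 := by
      rw [← NNReal.coe_one, NNReal.coe_le_coe]
      refine div_le_one_of_le₀ ?_ zero_le
      rw [Finset.mem_range] at hi
      exact_mod_cast Nat.le_of_lt_succ hi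
    calc _ ≤ 9 * sqConst * ((U * 1 : ℝ) ^ 2 * δ) ^ 2 / η ^ 4 := by gcongr
      _ = _ := by ring
  have hGle : ∀ m, ∀ i ∈ Finset.range (2 ^ (l + m + 1)), P (G m i) ≤ ENNReal.ofReal
      (diffConst * U ^ 4 * (1 / 2 ^ (l + m + 1)) ^ 2 / (η * (9 / 10) ^ m) ^ 4) := fun m i hi => by
    refine (hW.measure_exists_lt_abs_deviation_sub_le hp U (t := i / 2 ^ (l + m + 1))
      (t' := (i + 1) / 2 ^ (l + m + 1)) (by gcongr; exact le_self_add) ?_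
      (by positivity)).trans_eq ?_
    · refine div_le_one_of_le₀ ?_ zero_le
      rw [Finset.mem_range] at hi
      exact_mod_cast hi
    · congr 4
      push_cast
      ring
  have h1 : P (⋃ i ∈ Finset.range (2 ^ l + 1), A i)
      ≤ ENNReal.ofReal (18 * sqConst * U ^ 4 / η ^ 4 * δ) := by
    refine (measure_biUnion_finset_le _ _).trans ((Finset.sum_le_sum hAle).trans ?_)
    rw [Finset.sum_const, Finset.card_range, nsmul_eq_mul, ← ENNReal.ofReal_natCast,
      ← ENNReal.ofReal_mul (by positivity)]
    refine ENNReal.ofReal_le_ofReal ?_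
    have h2 : ((2 ^ l + 1 : ℕ) : ℝ) * δ ≤ 2 := by
      push_cast
      rw [le_div_iff₀ hδ0] at hl1
      linarith
    calc ((2 ^ l + 1 : ℕ) : ℝ) * (9 * sqConst * U ^ 4 * δ ^ 2 / η ^ 4)
        = (9 * sqConst * U ^ 4 / η ^ 4 * δ) * (((2 ^ l + 1 : ℕ) : ℝ) * δ) := by ring
      _ ≤ (9 * sqConst * U ^ 4 / η ^ 4 * δ) * 2 := by gcongr
      _ = _ := by ring
  have h2 : P (⋃ m, ⋃ i ∈ Finset.range (2 ^ (l + m + 1)), G m i)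
      ≤ ENNReal.ofReal (5 * diffConst * U ^ 4 / η ^ 4 * δ) := by
    set c : ℝ := diffConst * U ^ 4 / η ^ 4 * δ with hc
    have hc0 : 0 ≤ c := by positivity
    have hm : ∀ m, P (⋃ i ∈ Finset.range (2 ^ (l + m + 1)), G m i)
        ≤ ENNReal.ofReal (c * (4 / 5) ^ m) := fun m => by
      refine (measure_biUnion_finset_le _ _).trans ((Finset.sum_le_sum (hGle m)).trans ?_)
      rw [Finset.sum_const, Finset.card_range, nsmul_eq_mul, ← ENNReal.ofReal_natCast,
        ← ENNReal.ofReal_mul (by positivity)]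
      refine ENNReal.ofReal_le_ofReal ?_
      have h3 : (1 : ℝ) / 2 ^ (l + 1) ≤ δ := by
        rw [div_le_iff₀ (by positivity)]
        rw [div_lt_iff₀ hδ0] at hl2
        linarith
      -- The ratio is `1 / (2 * 0.9 ^ 4) ≈ 0.762`; the threshold factor `9 / 10` is close enough to
      -- `1` to keep it below `4 / 5`, whose geometric series sums to `5`.
      have h4 : (1 : ℝ) / 2 ^ m / ((9 / 10) ^ m) ^ 4 ≤ (4 / 5) ^ m := by
        rw [← pow_mul, mul_comm m 4, pow_mul, ← one_div_pow, ← div_pow]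
        exact pow_le_pow_left₀ (by positivity) (by norm_num) m
      calc ((2 ^ (l + m + 1) : ℕ) : ℝ) *
            (diffConst * U ^ 4 * (1 / 2 ^ (l + m + 1)) ^ 2 / (η * (9 / 10) ^ m) ^ 4)
          = diffConst * U ^ 4 / η ^ 4 * (1 / 2 ^ (l + 1)) * (1 / 2 ^ m / ((9 / 10) ^ m) ^ 4) := by
            push_cast
            rw [show l + m + 1 = (l + 1) + m by ring, pow_add _ (l + 1) m]
            field_simp
        _ ≤ diffConst * U ^ 4 / η ^ 4 * δ * (4 / 5) ^ m := by gcongr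
    refine (measure_iUnion_le _).trans ((ENNReal.tsum_le_tsum hm).trans_eq ?_)
    have hs : Summable fun m : ℕ => c * (4 / 5 : ℝ) ^ m :=
      (summable_geometric_of_lt_one (by norm_num) (by norm_num)).mul_left c
    rw [← ENNReal.ofReal_tsum_of_nonneg (fun m => by positivity) hs, tsum_mul_left,
      tsum_geometric_of_lt_one (by norm_num) (by norm_num)]
    congr 1
    rw [hc]
    ring
  refine (measure_mono hsub).trans ((measure_union_le _ _).trans ((add_le_add h1 h2).trans_eq ?_))
  rw [← ENNReal.ofReal_add (by positivity) (by positivity)]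
  congr 1
  unfold tailConst
  ring

/-- If the meshes are summable, the sums of squared increments converge uniformly in both
parameters, almost surely. -/
theorem IsBrownianSheet.ae_eventually_deviation_le {S : Type*} [MeasurableSpace S]
    {P : Measure S} {W : S → C(ℝ≥0 × ℝ≥0, ℝ)} (hW : IsBrownianSheet P W)
    {p : ℕ → ℕ → ℝ≥0} {k : ℕ → ℕ} {δ : ℕ → ℝ} (hp : ∀ n, IsPartitionSeq (p n) (k n) (δ n))
    (hδ0 : ∀ n, 0 < δ n) (hδ1 : ∀ n, δ n ≤ 1) (hδ : Summable δ) (U : ℝ≥0) :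
    ∀ᵐ ω ∂P, ∀ M : ℕ, ∀ᶠ n in Filter.atTop, ∀ u ≤ U, ∀ t ≤ 1,
      |deviation (p n) (k n) (W ω) u t| ≤ 1 / (M + 1) := by
  refine ae_all_iff.2 fun M => ?_
  set η : ℝ := 1 / (M + 1) / 11 with hη_def
  have hη : 0 < η := by positivity
  have h := ae_eventually_notMem (μ := P) (s := fun n =>
    {ω | ∃ u ≤ U, ∃ t ≤ 1, 11 * η < |deviation (p n) (k n) (W ω) u t|}) ?_
  · filter_upwards [h] with ω hω
    filter_upwards [hω] with n hn u hu t ht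
    by_contra! hcon
    refine hn ⟨u, hu, t, ht, ?_⟩
    rw [hη_def, mul_div_cancel₀ _ (by norm_num)]
    exact hcon
  · refine ne_top_of_le_ne_top ?_ (ENNReal.tsum_le_tsum fun n =>
      hW.measure_exists_deviation_gt_le (hp n) (hδ0 n) (hδ1 n) U hη)
    exact (hδ.mul_left _).tsum_ofReal_ne_top

/-! ### Translation to the Ornstein–Uhlenbeck process and conclusion. -/

/-- The points of a partition of `[0, 1]` as a sequence of nonnegative reals, constant from the
last point on. -/
noncomputable def partitionSeq {k : ℕ} (π : Fin (k + 1) → unitInterval) (j : ℕ) : ℝ≥0 :=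
  if h : j < k + 1 then unitInterval.toNNReal (π ⟨j, h⟩) else 1

theorem partitionSeq_val {k : ℕ} (π : Fin (k + 1) → unitInterval) (i : Fin (k + 1)) :
    partitionSeq π i = unitInterval.toNNReal (π i) := dif_pos i.2

theorem sub_le_mesh {k : ℕ} (π : Fin (k + 1) → unitInterval) (j : Fin k) :
    (π j.succ : ℝ) - π j.castSucc ≤ mesh π :=
  le_ciSup (f := fun j : Fin k => (π j.succ : ℝ) - π j.castSucc) (Set.finite_range _).bddAbove j

namespace IsPartition

variable {k : ℕ} {π : Fin (k + 1) → unitInterval}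

theorem pos (hπ : IsPartition π) : 0 < k := by
  rcases Nat.eq_zero_or_pos k with rfl | h
  · have := hπ.first.symm.trans hπ.last
    exact absurd this zero_ne_one
  · exact h

theorem mesh_pos (hπ : IsPartition π) : 0 < mesh π := by
  have h := sub_le_mesh π ⟨0, hπ.pos⟩
  have h2 : (π (Fin.castSucc ⟨0, hπ.pos⟩) : ℝ) < π (Fin.succ ⟨0, hπ.pos⟩) :=
    hπ.strictMono Fin.castSucc_lt_succ
  linarith

theorem mesh_le_one (hπ : IsPartition π) : mesh π ≤ 1 := by
  have : Nonempty (Fin k) := ⟨⟨0, hπ.pos⟩⟩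
  refine ciSup_le fun j => ?_
  linarith [(π j.succ).2.2, (π j.castSucc).2.1]

theorem isPartitionSeq (hπ : IsPartition π) : IsPartitionSeq (partitionSeq π) k (mesh π) where
  mono := by
    refine monotone_nat_of_le_succ fun j => ?_
    unfold partitionSeq
    by_cases h1 : j + 1 < k + 1
    · rw [dif_pos h1, dif_pos (by omega : j < k + 1)]
      exact hπ.strictMono.monotone (Fin.mk_le_mk.2 (Nat.le_succ j))
    · rw [dif_neg h1]
      split_ifs with h2
      · exact (π ⟨j, h2⟩).2.2
      · exact le_rfl
  zero := by
    have h := partitionSeq_val π 0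
    rw [hπ.first] at h
    exact h
  one := by
    have h := partitionSeq_val π (Fin.last k)
    rw [hπ.last] at h
    exact h
  le := fun j hj => by
    have h1 := partitionSeq_val π (Fin.castSucc ⟨j, hj⟩)
    have h2 := partitionSeq_val π (Fin.succ ⟨j, hj⟩)
    simp only [Fin.val_castSucc, Fin.val_succ] at h1 h2
    rw [h1, h2]
    exact sub_le_mesh π ⟨j, hj⟩

end IsPartition

/-- The sum of the squared increments of the Ornstein–Uhlenbeck path at time `r`, centred at its
limit, in terms of the sheet. -/
theorem sum_sq_ou_sub {k : ℕ} {π : Fin (k + 1) → unitInterval}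
    (w : C(ℝ≥0 × ℝ≥0, ℝ)) (r : ℝ≥0) (t : unitInterval) {f : C(unitInterval, ℝ)}
    (hf : f = ouProcess w r) :
    ∑ j : Fin k, |f (π j.succ * t) - f (π j.castSucc * t)| ^ 2 - t
      = Real.exp (-r) *
        deviation (partitionSeq π) k w (Real.exp r).toNNReal (unitInterval.toNNReal t) := by
  subst hf
  have hexp : Real.exp (-(r : ℝ)) = Real.exp (-(r : ℝ) / 2) ^ 2 := by
    rw [← Real.exp_nat_mul]
    congr 1
    push_cast
    ring
  have hexp1 : Real.exp (-(r : ℝ)) * Real.exp r = 1 := by rw [← Real.exp_add]; simp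
  have hmul : ∀ i : Fin (k + 1), unitInterval.toNNReal t * partitionSeq π i
      = unitInterval.toNNReal (π i * t) := fun i => by
    rw [partitionSeq_val]
    ext
    simp [mul_comm]
  unfold deviation quadVar
  rw [mul_sub, Real.coe_toNNReal _ (Real.exp_pos _).le, ← mul_assoc, hexp1, one_mul,
    Finset.sum_range, Finset.mul_sum]
  congr 1
  refine Finset.sum_congr rfl fun j _ => ?_
  have h1 := hmul j.castSucc
  have h2 := hmul j.succ
  simp only [Fin.val_castSucc, Fin.val_succ] at h1 h2
  rw [h1, h2, sq_abs, hexp, ← mul_pow, mul_sub]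
  rfl

theorem theorem7p1 {S : Type*} [MeasurableSpace S] (P : Measure S) [IsProbabilityMeasure P]
    (W : S → C(ℝ≥0 × ℝ≥0, ℝ)) (hW : IsBrownianSheet P W)
    (k : ℕ → ℕ) (π : (n : ℕ) → Fin (k n + 1) → unitInterval)
    (hπ : ∀ n, IsPartition (π n))
    (hmesh : Summable (fun n => mesh (π n))) :
    QuasiEvery P W (fun f => ∀ t : unitInterval,
      Filter.Tendsto
        (fun n => ∑ j : Fin (k n), |f (π n j.succ * t) - f (π n j.castSucc * t)| ^ 2)
        Filter.atTop (nhds (t : ℝ))) := by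
  set Q : ℕ → C(unitInterval, ℝ) → unitInterval → ℝ := fun n f t =>
    ∑ j : Fin (k n), |f (π n j.succ * t) - f (π n j.castSucc * t)| ^ 2 with hQ
  have hclosed : ∀ (M n : ℕ) (t : unitInterval), IsClosed
      {f : C(unitInterval, ℝ) | |Q n f t - t| ≤ 1 / ((M : ℝ) + 1)} := fun M n t => by
    refine isClosed_le ?_ continuous_const
    simp only [hQ]
    fun_prop
  -- This is the set of uniform convergence in `t`. Uniformity makes it Borel: for fixed `n` the
  -- uncountable intersection over `t` is one of closed sets, hence closed, and the other operations
  -- are countable.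
  refine ⟨⋂ M : ℕ, ⋃ N : ℕ, ⋂ n : ℕ, ⋂ _ : N ≤ n, ⋂ t : unitInterval,
    {f | |Q n f t - t| ≤ 1 / ((M : ℝ) + 1)}, ⟨?_, ?_⟩, ?_⟩
  · let _ : MeasurableSpace C(unitInterval, ℝ) := borel _
    have : BorelSpace C(unitInterval, ℝ) := ⟨rfl⟩
    exact .iInter fun M => .iUnion fun N => .iInter fun n => .iInter fun _ =>
      (isClosed_iInter (hclosed M n)).measurableSet
  · unfold wienerCap
    have hzero : ∀ s : ℝ, P {ω | ∃ r : ℝ≥0, (r : ℝ) ≤ s ∧ ouProcess (W ω) r ∈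
        (⋂ M : ℕ, ⋃ N : ℕ, ⋂ n : ℕ, ⋂ _ : N ≤ n, ⋂ t : unitInterval,
          {f | |Q n f t - t| ≤ 1 / ((M : ℝ) + 1)})ᶜ} = 0 := fun s => by
      have h := hW.ae_eventually_deviation_le (fun n => (hπ n).isPartitionSeq)
        (fun n => (hπ n).mesh_pos) (fun n => (hπ n).mesh_le_one) hmesh (Real.exp s).toNNReal
      refine measure_mono_null ?_ (ae_iff.1 h)
      rintro ω ⟨r, hr, hmem⟩ hω
      refine hmem (Set.mem_iInter.2 fun M => Set.mem_iUnion.2 ?_)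
      obtain ⟨N, hN⟩ := Filter.eventually_atTop.1 (hω M)
      refine ⟨N, ?_⟩
      simp only [Set.mem_iInter]
      intro n hn t
      have h1 := hN n hn (Real.exp r).toNNReal
        (Real.toNNReal_le_toNNReal (Real.exp_le_exp.2 hr)) (unitInterval.toNNReal t) t.2.2
      show |Q n (ouProcess (W ω) r) t - t| ≤ _
      simp only [hQ]
      -- The factor `e^(-r)` is at most `1`, so the bound at sheet level `e^r ≤ e^s` carries over
      -- directly.
      rw [sum_sq_ou_sub (W ω) r t rfl, abs_mul, abs_of_pos (Real.exp_pos _)]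
      refine (mul_le_of_le_one_left (abs_nonneg _) ?_).trans h1
      exact Real.exp_le_one_iff.2 (neg_nonpos.2 r.2)
    simp only [hzero, mul_zero, lintegral_zero]
  · intro f hf t
    rw [Metric.tendsto_atTop]
    intro ε hε
    obtain ⟨M, hM⟩ := exists_nat_one_div_lt hε
    obtain ⟨N, hN⟩ := Set.mem_iUnion.1 (Set.mem_iInter.1 hf M)
    simp only [Set.mem_iInter] at hN
    refine ⟨N, fun n hn => ?_⟩
    rw [Real.dist_eq]
    exact lt_of_le_of_lt (hN n hn t) hM
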